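/- Let $k\ge 0$ and let $(\Lambda,d)$ be a countable finitely aligned $k$-graph: $\Lambda$ is a countable small category, identified with its set of morphisms (an object being identified with its identity morphism), with range and source maps $r,s$ and a degree functor $d:\Lambda\to\mathbb N^k$ such that whenever $d(\lambda)=m+n$ there are unique $\mu,\nu\in\Lambda$ with $\lambda=\mu\nu$, $d(\mu)=m$, $d(\nu)=n$; and for all $\lambda,\mu\in\Lambda$ the set $\Lambda^{\min}(\lambda,\mu)=\{(\alpha,\beta):\lambda\alpha=\mu\beta,\ d(\lambda\alpha)=d(\lambda)\vee d(\mu)\}$ is finite. Let $S_\Lambda$ be the set of all finite $F\subseteq\{(\lambda,\mu)\in\Lambda\times\Lambda: s(\lambda)=s(\mu)\}$ such that $\Lambda^{\min}(\lambda,\nu)=\emptyset=\Lambda^{\min}(\mu,\omega)$ for all distinct $(\lambda,\mu),(\nu,\omega)\in F$, with the product $FG=\bigcup_{(\lambda,\mu)\in F,\,(\xi,\eta)\in G}\{(\lambda\alpha,\eta\beta):(\alpha,\beta)\in\Lambda^{\min}(\mu,\xi)\}$ and the involution $F^*=\{(\mu,\lambda):(\lambda,\mu)\in F\}$. For $m\in(\mathbb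 N\cup\{\infty\})^k$ let $\Omega_{k,m}$ be the $k$-graph of all pairs $(p,q)$ in $\mathbb N^k$ with $p\le q\le m$, where $r(p,q)=p$, $s(p,q)=q$, $d(p,q)=q-p$. Let $X_\Lambda$ be the set of all degree-preserving functors $x:\Omega_{k,m}\to\Lambda$, $m\in(\mathbb N\cup\{\infty\})^k$; write $d(x)=m$ and $r(x)=x(0,0)$. For $F\in S_\Lambda$ let $D_F$ be the set of $x\in X_\Lambda$ such that $x(0,d(\mu))=\mu$ for some (necessarily unique) $(\lambda,\mu)\in F$, and for such $x$ let $\theta_F(x)=\lambda\,x(d(\mu),d(x))$ be the path obtained from $x$ by replacing its initial segment $\mu$ by $\lambda$. Give $X_\Lambda$ the topology with subbasis $\{D_F,\ X_\Lambda\setminus D_F: F\in S_\Lambda\}$. Let $\mathcal G_\Lambda$ be the set of equivalence classes $[F,x]$ of pairs $(F,x)$ with $F\in S_\Lambda$, $x\in D_F$, where $(F,x)\sim(G,y)$ iff $x=y$ and $FP=GP$ for some idempotent $P\in S_\Lambda$ with $x\in D_P$. It is a groupoid under $[F,\theta_G(x)]\,[G,x]=[FG,x]$ and $[F,x]^{-1}=[F^*,\theta_F(x)]$.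 For $F\in S_\Lambda$ put $\Psi(F)=\{[F,x]:x\in D_F\}$, and give $\mathcal G_\Lambda$ the topology with subbasis $\{\Psi(F),\ \mathcal G_\Lambda\setminus\Psi(F):F\in S_\Lambda\}$. For a topological groupoid $G$ with unit space $G^{(0)}$, a compact open bisection is a compact open Hausdorff subset $A\subseteq G$ on which the range map $g\mapsto gg^{-1}$ and the source map $g\mapsto g^{-1}g$ restrict to homeomorphisms onto open subsets of $G^{(0)}$; $G$ is called ample if it is locally compact, $G^{(0)}$ is open in $G$, and the compact open bisections form a basis of the topology of $G$. **Proposition.** 1. $\mathcal G_\Lambda$ is a second countable, locally compact, Hausdorff topological groupoid, and it is ample. 2. The map $x\mapsto[\{(r(x),r(x))\},x]$ is a homeomorphism of $X_\Lambda$ onto the unit space $\mathcal G_\Lambda^{(0)}$. Under this identification, $[F,x]$ has range $\theta_F(x)$ and source $x$. 3. Each $\Psi(F)$, $F\in S_\Lambda$, is a compact open bisection of $\mathcal G_\Lambda$, and $F\mapsto\Psi(F)$ is an injective $*$-homomorphism: $\Psi(F)=\Psi(G)$ only if $F=G$, $\Psi(FG)=\Psi(F)\Psi(G)=\{gh: g\in\Psi(F),\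 h\in\Psi(G),\ gh \text{ defined}\}$, and $\Psi(F^*)=\Psi(F)^{-1}$. -/

import Mathlib

universe u v

/-- A `k`-graph in the "arrows only" presentation: `Λ` is the set of morphisms (paths) of a small
category, an object is identified with its identity morphism, and `r`, `s` send a path to (the
identity at) its range and source. `comp a b` is the composite `ab`, which is meaningful only
when `s a = r b`; no law, and no definition below, uses its values on other pairs.
`d` is the degree functor, and `factorization` is the unique factorization property. -/
class KGraph (k : outParam ℕ) (Λ : Type u) where
  r : Λ → Λ
  s : Λ → Λ
  comp : Λ → Λ → Λ
  d : Λ → Fin k → ℕ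
  r_r : ∀ a, r (r a) = r a
  s_r : ∀ a, s (r a) = r a
  r_s : ∀ a, r (s a) = s a
  s_s : ∀ a, s (s a) = s a
  r_comp : ∀ a b, s a = r b → r (comp a b) = r a
  s_comp : ∀ a b, s a = r b → s (comp a b) = s b
  id_comp : ∀ a, comp (r a) a = a
  comp_id : ∀ a, comp a (s a) = a
  assoc : ∀ a b c, s a = r b → s b = r c → comp (comp a b) c = comp a (comp b c)
  d_comp : ∀ a b, s a = r b → d (comp a b) = d a + d b
  factorization : ∀ (a : Λ) (m n : Fin k → ℕ), d a = m + n →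
    ∃! p : Λ × Λ, s p.1 = r p.2 ∧ comp p.1 p.2 = a ∧ d p.1 = m ∧ d p.2 = n

namespace KGraph

/-! ### Elementary facts about paths -/

section Paths

variable {k : ℕ} {Λ : Type u} [KGraph k Λ]

theorem d_r (a : Λ) : d (r a) = 0 := by
  have h := d_comp (r a) (r a) (by rw [s_r, r_r])
  have h2 : comp (r a) (r a) = r a := by
    have := id_comp (r a)
    rwa [r_r] at this
  rw [h2] at h
  exact left_eq_add.mp h

theorem d_s (a : Λ) : d (s a) = 0 := by
  rw [← r_s, d_r]

theorem fact_unique {b c b' c' : Λ} (h : s b = r c) (h' : s b' = r c')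
    (e : comp b c = comp b' c') (hd : d b = d b') : b = b' ∧ c = c' := by
  have hc : d c = d c' := by
    have h1 := d_comp b c h
    rw [e, d_comp b' c' h', hd] at h1
    exact (add_left_cancel h1).symm
  have := (factorization (comp b c) (d b) (d c) (d_comp b c h)).unique
    (y₁ := (b, c)) (y₂ := (b', c')) ⟨h, rfl, rfl, rfl⟩ ⟨h', e.symm, hd.symm, hc.symm⟩
  exact ⟨congrArg Prod.fst this, congrArg Prod.snd this⟩

theorem eq_s_of_d {a c : Λ} (h : s a = r c) (hd : d c = 0) : c = s a := by
  have h1 : comp (r c) c = comp c (s c) := by rw [id_comp, comp_id]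
  have := (fact_unique (s_r c) (r_s c).symm h1 (by rw [d_r, hd])).1
  rw [h, this]

/-- `Pre b a` says that `b` is an initial segment of the path `a`. -/
def Pre (b a : Λ) : Prop := ∃ c, s b = r c ∧ comp b c = a

theorem Pre.refl (a : Λ) : Pre a a := ⟨s a, (r_s a).symm, comp_id a⟩

theorem Pre.trans {a b c : Λ} (h : Pre a b) (h' : Pre b c) : Pre a c := by
  obtain ⟨e, he, rfl⟩ := h
  obtain ⟨f, hf, rfl⟩ := h'
  rw [s_comp _ _ he] at hf
  exact ⟨comp e f, by rw [r_comp _ _ hf, he], (assoc _ _ _ he hf).symm⟩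

theorem Pre.d_le {a b : Λ} (h : Pre a b) : d a ≤ d b := by
  obtain ⟨e, he, rfl⟩ := h
  rw [d_comp _ _ he]
  exact le_self_add

theorem pre_comp {a b : Λ} (h : s a = r b) : Pre a (comp a b) := ⟨b, h, rfl⟩

theorem exists_pre {a : Λ} {n : Fin k → ℕ} (h : n ≤ d a) : ∃ b, Pre b a ∧ d b = n := by
  obtain ⟨p, ⟨h1, h2, h3, -⟩, -⟩ := factorization a n (d a - n) (add_tsub_cancel_of_le h).symm
  exact ⟨p.1, ⟨p.2, h1, h2⟩, h3⟩

theorem Pre.of_le {a b c : Λ} (h : Pre a c) (h' : Pre b c) (hd : d a ≤ d b) : Pre a b := by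
  obtain ⟨b', hb', e⟩ := exists_pre hd
  have h2 := hb'.trans h'
  obtain ⟨x, hx, hx'⟩ := h
  obtain ⟨y, hy, hy'⟩ := h2
  rw [(fact_unique hx hy (hx'.trans hy'.symm) e.symm).1]
  exact hb'

theorem Pre.eq {a b c : Λ} (h : Pre a c) (h' : Pre b c) (hd : d a = d b) : a = b := by
  obtain ⟨x, hx, hx'⟩ := h
  obtain ⟨y, hy, hy'⟩ := h'
  exact (fact_unique hx hy (hx'.trans hy'.symm) hd).1

theorem Pre.r_eq {a b : Λ} (h : Pre a b) : r a = r b := by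
  obtain ⟨c, hc, rfl⟩ := h
  rw [r_comp _ _ hc]

theorem comp_left_cancel {a b c : Λ} (h : s a = r b) (h' : s a = r c)
    (e : comp a b = comp a c) : b = c := (fact_unique h h' e rfl).2

theorem comp_right_cancel {a b c : Λ} (h : s a = r c) (h' : s b = r c)
    (e : comp a c = comp b c) : a = b := by
  refine (fact_unique h h' e ?_).1
  have := congrArg d e
  rw [d_comp _ _ h, d_comp _ _ h'] at this
  exact add_right_cancel this

end Paths

/-! ### The `k`-graphs `Ω_{k,m}` and the path space -/

/-- The morphisms of `Ω_{k,m}`: pairs `(p, q)` in `ℕᵏ` with `p ≤ q ≤ m`, where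
`m ∈ (ℕ ∪ {∞})ᵏ`. -/
@[ext]
structure Omega (k : ℕ) (m : Fin k → ℕ∞) : Type where
  fst : Fin k → ℕ
  snd : Fin k → ℕ
  le : fst ≤ snd
  le_deg : ∀ i, (snd i : ℕ∞) ≤ m i

namespace Omega

variable {k : ℕ} {m : Fin k → ℕ∞}

theorem fst_le_deg (a : Omega k m) (i : Fin k) : (a.fst i : ℕ∞) ≤ m i :=
  le_trans (by exact_mod_cast a.le i) (a.le_deg i)

open Classical in
/-- The `k`-graph structure of `Ω_{k,m}`: `r(p, q) = p`, `s(p, q) = q`, `d(p, q) = q - p`, where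
the object `p` is identified with `(p, p)`, and `(p, q)(q, t) = (p, t)`. -/
noncomputable instance : KGraph k (Omega k m) where
  r a := ⟨a.fst, a.fst, le_rfl, a.fst_le_deg⟩
  s a := ⟨a.snd, a.snd, le_rfl, a.le_deg⟩
  comp a b := if h : a.snd = b.fst then
      ⟨a.fst, b.snd, a.le.trans (h.le.trans b.le), b.le_deg⟩ else a
  d a := a.snd - a.fst
  r_r a := rfl
  s_r a := rfl
  r_s a := rfl
  s_s a := rfl
  r_comp a b h := by
    have h : a.snd = b.fst := congrArg Omega.fst h
    simp [h]
  s_comp a b h := by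
    have h : a.snd = b.fst := congrArg Omega.fst h
    simp [h]
  id_comp a := by simp
  comp_id a := by simp
  assoc a b c h h' := by
    have h : a.snd = b.fst := congrArg Omega.fst h
    have h' : b.snd = c.fst := congrArg Omega.fst h'
    simp [h, h']
  d_comp a b h := by
    have h : a.snd = b.fst := congrArg Omega.fst h
    rw [dif_pos h]
    funext i
    have h1 : a.fst i ≤ a.snd i := a.le i
    have h2 : b.fst i ≤ b.snd i := b.le i
    have h3 : a.snd i = b.fst i := congrFun h i
    simp only [Pi.sub_apply, Pi.add_apply]
    omega
  factorization a m' n h := by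
    have h0 : a.snd = a.fst + m' + n := by
      rw [add_assoc, ← h, add_tsub_cancel_of_le a.le]
    have hle : a.fst + m' ≤ a.snd := by rw [h0]; exact le_self_add
    refine ⟨(⟨a.fst, a.fst + m', le_self_add,
        fun i => le_trans (by exact_mod_cast hle i) (a.le_deg i)⟩,
      ⟨a.fst + m', a.snd, hle, a.le_deg⟩), ?_, ?_⟩
    · refine ⟨rfl, by simp, ?_, ?_⟩
      · exact add_tsub_cancel_left _ _
      · show a.snd - (a.fst + m') = n
        rw [h0]
        exact add_tsub_cancel_left _ _
    · rintro ⟨b, c⟩ ⟨h1, h2, h3, h4⟩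
      have h1 : b.snd = c.fst := congrArg Omega.fst h1
      simp only [h1, dif_pos] at h2
      have e1 : b.fst = a.fst := by rw [← h2]
      have e2 : c.snd = a.snd := by rw [← h2]
      have e3 : b.snd = a.fst + m' := by
        rw [← e1, ← h3]
        exact (add_tsub_cancel_of_le b.le).symm
      exact Prod.ext (Omega.ext e1 e3) (Omega.ext (h1.symm.trans e3) e2)

theorem comp_mk {p q t : Fin k → ℕ} (h1 : p ≤ q) (h2 : ∀ i, (q i : ℕ∞) ≤ m i) (h3 : q ≤ t)
    (h4 : ∀ i, (t i : ℕ∞) ≤ m i) : comp (⟨p, q, h1, h2⟩ : Omega k m) ⟨q, t, h3, h4⟩ =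
      ⟨p, t, h1.trans h3, h4⟩ :=
  dif_pos rfl

end Omega

/-- A morphism of `k`-graphs: a degree-preserving functor. -/
structure Hom {k : ℕ} (Λ₁ : Type u) (Λ₂ : Type v) [KGraph k Λ₁] [KGraph k Λ₂] where
  toFun : Λ₁ → Λ₂
  map_r : ∀ a, toFun (r a) = r (toFun a)
  map_s : ∀ a, toFun (s a) = s (toFun a)
  map_comp : ∀ a b, s a = r b → toFun (comp a b) = comp (toFun a) (toFun b)
  map_d : ∀ a, d (toFun a) = d a

/-- The path space `X_Λ`: all graph morphisms `x : Ω_{k,m} → Λ`, where `m = d(x)` ranges over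
`(ℕ ∪ {∞})ᵏ`. -/
structure PathSpace {k : ℕ} (Λ : Type u) [KGraph k Λ] where
  deg : Fin k → ℕ∞
  hom : Hom (Omega k deg) Λ

namespace PathSpace

variable {k : ℕ} {Λ : Type u} [KGraph k Λ]

/-- The path `x(p, q)`. -/
def seg (x : PathSpace Λ) (p q : Fin k → ℕ) (h : p ≤ q) (h' : ∀ i, (q i : ℕ∞) ≤ x.deg i) : Λ :=
  x.hom.toFun ⟨p, q, h, h'⟩

/-- The range `r(x) = x(0)`, that is, the identity path `x(0, 0)`. -/
def rng (x : PathSpace Λ) : Λ := x.seg 0 0 le_rfl (fun i => by simp)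

/-- `x.Starts b` says that `x(0, d(b)) = b` (and in particular `d(b) ≤ d(x)`). -/
def Starts (x : PathSpace Λ) (b : Λ) : Prop :=
  ∃ h : ∀ i, (d b i : ℕ∞) ≤ x.deg i, x.seg 0 (d b) (zero_le) h = b

theorem r_seg (x : PathSpace Λ) {p q : Fin k → ℕ} (h : p ≤ q) (h' : ∀ i, (q i : ℕ∞) ≤ x.deg i)
    (h'' : ∀ i, (p i : ℕ∞) ≤ x.deg i) : r (x.seg p q h h') = x.seg p p le_rfl h'' :=
  (x.hom.map_r _).symm

theorem s_seg (x : PathSpace Λ) {p q : Fin k → ℕ} (h : p ≤ q) (h' : ∀ i, (q i : ℕ∞) ≤ x.deg i) :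
    s (x.seg p q h h') = x.seg q q le_rfl h' :=
  (x.hom.map_s _).symm

theorem s_seg_eq (x : PathSpace Λ) {p q t : Fin k → ℕ} (h : p ≤ q)
    (h' : ∀ i, (q i : ℕ∞) ≤ x.deg i) (g : q ≤ t) (g' : ∀ i, (t i : ℕ∞) ≤ x.deg i) :
    s (x.seg p q h h') = r (x.seg q t g g') := by
  rw [s_seg, r_seg]

theorem comp_seg (x : PathSpace Λ) {p q t : Fin k → ℕ} (h : p ≤ q)
    (h' : ∀ i, (q i : ℕ∞) ≤ x.deg i) (g : q ≤ t) (g' : ∀ i, (t i : ℕ∞) ≤ x.deg i) :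
    comp (x.seg p q h h') (x.seg q t g g') = x.seg p t (h.trans g) g' := by
  have := x.hom.map_comp ⟨p, q, h, h'⟩ ⟨q, t, g, g'⟩ rfl
  rw [Omega.comp_mk] at this
  exact this.symm

theorem d_seg (x : PathSpace Λ) {p q : Fin k → ℕ} (h : p ≤ q)
    (h' : ∀ i, (q i : ℕ∞) ≤ x.deg i) : d (x.seg p q h h') = q - p := x.hom.map_d _

theorem starts_seg (x : PathSpace Λ) {n : Fin k → ℕ} (h' : ∀ i, (n i : ℕ∞) ≤ x.deg i) :
    x.Starts (x.seg 0 n zero_le h') := by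
  have e : d (x.seg 0 n zero_le h') = n := by rw [d_seg, tsub_zero]
  refine ⟨by rw [e]; exact h', ?_⟩
  congr 1

theorem Starts.pre {x : PathSpace Λ} {b c : Λ} (h : x.Starts b) (hc : Pre c b) : x.Starts c := by
  obtain ⟨hb, e⟩ := h
  have hd := hc.d_le
  have hc' : ∀ i, (d c i : ℕ∞) ≤ x.deg i := fun i =>
    le_trans (by exact_mod_cast hd i) (hb i)
  refine ⟨hc', ?_⟩
  refine Pre.eq (c := b) ⟨_, s_seg_eq x zero_le hc' hd hb, ?_⟩ hc ?_
  · rw [comp_seg, e]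
  · rw [d_seg, tsub_zero]

theorem Starts.extend {x : PathSpace Λ} {b : Λ} {n : Fin k → ℕ} (h : x.Starts b) (hn : d b ≤ n)
    (hn' : ∀ i, (n i : ℕ∞) ≤ x.deg i) : ∃ e, Pre b e ∧ d e = n ∧ x.Starts e := by
  refine ⟨x.seg 0 n zero_le hn', ?_, by rw [d_seg, tsub_zero], starts_seg x hn'⟩
  obtain ⟨hb, e⟩ := h
  refine ⟨x.seg (d b) n hn hn', ?_, ?_⟩
  · conv_lhs => rw [← e]
    exact s_seg_eq x zero_le hb hn hn'
  · conv_lhs => enter [1]; rw [← e]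
    rw [comp_seg]

theorem Starts.directed {x : PathSpace Λ} {b c : Λ} (h : x.Starts b) (h' : x.Starts c) :
    ∃ e, x.Starts e ∧ Pre b e ∧ Pre c e := by
  have hn : ∀ i, ((d b ⊔ d c) i : ℕ∞) ≤ x.deg i := fun i => by
    rcases le_total (d b i) (d c i) with g | g
    · simpa [g] using h'.1 i
    · simpa [g] using h.1 i
  obtain ⟨e, h1, h2, h3⟩ := h.extend le_sup_left hn
  obtain ⟨e', h1', h2', h3'⟩ := h'.extend le_sup_right hn
  have : e = e' := by
    obtain ⟨_, q⟩ := h3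
    obtain ⟨_, q'⟩ := h3'
    rw [← q, ← q']
    congr 1
    rw [h2, h2']
  subst this
  exact ⟨e, h3, h1, h1'⟩

theorem Starts.rng_eq {x : PathSpace Λ} {b : Λ} (h : x.Starts b) : r b = x.rng := by
  obtain ⟨hb, e⟩ := h
  conv_lhs => rw [← e]
  exact r_seg x _ _ _

theorem starts_rng (x : PathSpace Λ) : x.Starts x.rng := starts_seg x _

theorem r_rng (x : PathSpace Λ) : r x.rng = x.rng := (starts_rng x).rng_eq

theorem s_rng (x : PathSpace Λ) : s x.rng = x.rng := by
  rw [← r_rng, s_r]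

theorem ext_starts {x y : PathSpace Λ} (h : ∀ b, x.Starts b ↔ y.Starts b) : x = y := by
  have key : ∀ x y : PathSpace Λ, (∀ b, x.Starts b → y.Starts b) → ∀ i, x.deg i ≤ y.deg i := by
    intro x y h i
    refine ENat.forall_natCast_le_iff_le.mp fun n hn => ?_
    have hn' : ∀ j, ((Pi.single i n : Fin k → ℕ) j : ℕ∞) ≤ x.deg j := fun j => by
      rcases eq_or_ne j i with rfl | hj
      · simpa using hn
      · simp [hj]
    have h1 := (h _ (starts_seg x hn')).1 i
    rw [d_seg] at h1
    simpa using h1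
  have hdeg : x.deg = y.deg := funext fun i =>
    le_antisymm (key x y (fun b => (h b).1) i) (key y x (fun b => (h b).2) i)
  obtain ⟨m, f⟩ := x
  obtain ⟨m', g⟩ := y
  obtain rfl : m = m' := hdeg
  suffices e : f.toFun = g.toFun by
    obtain ⟨f1, _, _, _, _⟩ := f
    obtain ⟨g1, _, _, _, _⟩ := g
    obtain rfl : f1 = g1 := e
    rfl
  funext pq
  obtain ⟨p, q, hpq, hq⟩ := pq
  have hp : ∀ i, (p i : ℕ∞) ≤ m i := fun i => le_trans (by exact_mod_cast hpq i) (hq i)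
  have h0 : ∀ n (hn : ∀ i, (n i : ℕ∞) ≤ m i),
      seg (⟨m, f⟩ : PathSpace Λ) 0 n zero_le hn = seg (⟨m, g⟩ : PathSpace Λ) 0 n zero_le hn := by
    intro n hn
    obtain ⟨_, e⟩ := (h _).1 (starts_seg (⟨m, f⟩ : PathSpace Λ) hn)
    rw [← e]
    congr 1
    rw [d_seg, tsub_zero]
  have e1 := comp_seg (⟨m, f⟩ : PathSpace Λ) zero_le hp hpq hq
  have e2 := comp_seg (⟨m, g⟩ : PathSpace Λ) zero_le hp hpq hq
  rw [h0 q hq, ← e2, h0 p hp] at e1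
  refine comp_left_cancel ?_ (s_seg_eq (⟨m, g⟩ : PathSpace Λ) zero_le hp hpq hq) e1
  rw [← h0 p hp]
  exact s_seg_eq (⟨m, f⟩ : PathSpace Λ) zero_le hp hpq hq

/-- A coherent family of initial segments, one in each degree `n ≤ m`, is the family of initial
segments of an element of the path space. -/
theorem exists_of_prefixes (m : Fin k → ℕ∞)
    (f : (n : Fin k → ℕ) → (∀ i, (n i : ℕ∞) ≤ m i) → Λ)
    (hd : ∀ n hn, d (f n hn) = n)
    (hf : ∀ n hn n' hn', n ≤ n' → Pre (f n hn) (f n' hn')) :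
    ∃ x : PathSpace Λ, x.deg = m ∧ ∀ b, x.Starts b ↔ ∃ h : ∀ i, (d b i : ℕ∞) ≤ m i,
      f (d b) h = b := by
  have hle := fun a : Omega k m => a.fst_le_deg
  choose g hg1 hg2 using fun a : Omega k m => hf a.fst (hle a) a.snd a.le_deg a.le
  have uniq : ∀ (a : Omega k m) (c : Λ), s (f a.fst (hle a)) = r c →
      comp (f a.fst (hle a)) c = f a.snd a.le_deg → g a = c := fun a c h h' =>
    comp_left_cancel (hg1 a) h ((hg2 a).trans h'.symm)
  have hsg : ∀ a, s (g a) = s (f a.snd a.le_deg) := fun a => by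
    rw [← hg2 a, s_comp _ _ (hg1 a)]
  refine ⟨⟨m, ⟨g, ?_, ?_, ?_, ?_⟩⟩, rfl, ?_⟩
  · intro a
    refine uniq _ _ ?_ ?_
    · rw [r_r]; exact hg1 a
    · rw [← hg1 a]; exact comp_id _
  · intro a
    refine uniq _ _ ?_ ?_
    · rw [r_s, hsg]; rfl
    · rw [hsg]; exact comp_id _
  · intro a b hab
    obtain ⟨p, q, h1, h2⟩ := a
    obtain ⟨q', t, h3, h4⟩ := b
    obtain rfl : q = q' := congrArg Omega.fst hab
    set a : Omega k m := ⟨p, q, h1, h2⟩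
    set b : Omega k m := ⟨q, t, h3, h4⟩
    have e : comp a b = ⟨p, t, h1.trans h3, h4⟩ := Omega.comp_mk h1 h2 h3 h4
    have hgab : s (g a) = r (g b) := (hsg a).trans (hg1 b)
    rw [e]
    refine uniq _ _ ?_ ?_
    · rw [r_comp _ _ hgab]; exact hg1 a
    · rw [← assoc _ _ _ (hg1 a) hgab]
      refine Eq.trans ?_ (hg2 b)
      congr 1
      exact hg2 a
  · intro a
    have h1 := d_comp _ _ (hg1 a)
    rw [hg2, hd, hd] at h1
    show _ = a.snd - a.fst
    rw [h1]
    exact (add_tsub_cancel_left _ _).symm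
  · intro b
    have h00 : ∀ n (hn : ∀ i, (n i : ℕ∞) ≤ m i), g ⟨0, n, zero_le, hn⟩ = f n hn := by
      intro n hn
      set a : Omega k m := ⟨0, n, zero_le, hn⟩
      have hz : f 0 (hle a) = r (f n hn) := by
        have hp : Pre (f 0 (hle a)) (f n hn) := hf _ _ _ _ zero_le
        refine hp.eq (b := r (f n hn)) ⟨f n hn, s_r _, id_comp _⟩ ?_
        rw [d_r, hd]
      refine uniq a _ ?_ ?_
      · show s (f 0 (hle a)) = _
        rw [hz, s_r]
      · show comp (f 0 (hle a)) _ = _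
        rw [hz, id_comp]
    exact exists_congr fun h => by rw [← h00]; rfl

/-- The path `x(m, d(x))` obtained from `x` by removing its initial segment of degree `m`. -/
noncomputable def tail (x : PathSpace Λ) (m : Fin k → ℕ) (hm : ∀ i, (m i : ℕ∞) ≤ x.deg i) :
    PathSpace Λ where
  deg i := x.deg i - (m i : ℕ∞)
  hom :=
    have hb : ∀ q : Fin k → ℕ, (∀ i, (q i : ℕ∞) ≤ x.deg i - (m i : ℕ∞)) →
        ∀ i, ((q + m) i : ℕ∞) ≤ x.deg i := fun q hq i => by
      have h := add_le_add_left (hq i) (m i : ℕ∞)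
      rw [tsub_add_cancel_of_le (hm i)] at h
      simpa using h
    { toFun := fun a => x.seg (a.fst + m) (a.snd + m) (add_le_add_left a.le m) (hb _ a.le_deg)
      map_r := fun a => (r_seg x _ _ _).symm
      map_s := fun a => (s_seg x _ _).symm
      map_comp := by
        rintro ⟨p, q, h1, h2⟩ ⟨q', t, h3, h4⟩ hab
        obtain rfl : q = q' := congrArg Omega.fst hab
        rw [comp_seg]
        exact congrArg (fun a : Omega k _ => x.seg (a.fst + m) (a.snd + m)
          (add_le_add_left a.le m) (hb _ a.le_deg)) (Omega.comp_mk h1 h2 h3 h4)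
      map_d := fun a => by
        rw [d_seg]
        exact add_tsub_add_eq_tsub_right _ _ _ }

theorem Starts.unique {x : PathSpace Λ} {b c : Λ} (h : x.Starts b) (h' : x.Starts c)
    (e : d b = d c) : b = c := by
  obtain ⟨f, -, h1, h2⟩ := h.directed h'
  exact h1.eq h2 e

theorem starts_tail_iff {x : PathSpace Λ} {b : Λ} (h : x.Starts b) (c : Λ) :
    (x.tail (d b) h.1).Starts c ↔ s b = r c ∧ x.Starts (comp b c) := by
  have key : ∀ n (hn : ∀ i, ((n + d b) i : ℕ∞) ≤ x.deg i)
      (hn' : ∀ i, (n i : ℕ∞) ≤ (x.tail (d b) h.1).deg i),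
      s b = r ((x.tail (d b) h.1).seg 0 n zero_le hn') ∧
      comp b ((x.tail (d b) h.1).seg 0 n zero_le hn') = x.seg 0 (n + d b) zero_le hn := by
    intro n hn hn'
    have e : (x.tail (d b) h.1).seg 0 n zero_le hn' =
        x.seg (d b) (n + d b) le_add_self hn := by
      show x.seg (0 + d b) (n + d b) _ _ = _
      congr 1
      exact zero_add _
    obtain ⟨hb, e'⟩ := h
    rw [e]
    constructor
    · conv_lhs => rw [← e']
      exact s_seg_eq x zero_le hb le_add_self hn
    · conv_lhs => enter [1]; rw [← e']
      exact comp_seg x zero_le hb le_add_self hn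
  constructor
  · rintro ⟨hc, e⟩
    have hn : ∀ i, ((d c + d b) i : ℕ∞) ≤ x.deg i := fun i => by
      have h1 := add_le_add_left (hc i) (d b i : ℕ∞)
      change _ ≤ (x.deg i - (d b i : ℕ∞)) + _ at h1
      rw [tsub_add_cancel_of_le (h.1 i)] at h1
      simpa using h1
    obtain ⟨h1, h2⟩ := key (d c) hn hc
    rw [e] at h1 h2
    exact ⟨h1, h2 ▸ starts_seg x hn⟩
  · rintro ⟨h1, hc, e⟩
    have e2 : d (comp b c) = d c + d b := by rw [d_comp _ _ h1, add_comm]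
    have hn : ∀ i, ((d c + d b) i : ℕ∞) ≤ x.deg i := e2 ▸ hc
    have hc' : ∀ i, (d c i : ℕ∞) ≤ (x.tail (d b) h.1).deg i := fun i => by
      show _ ≤ x.deg i - (d b i : ℕ∞)
      refine ENat.le_sub_of_add_le_right (ENat.natCast_ne_top _) ?_
      simpa using hn i
    refine ⟨hc', ?_⟩
    obtain ⟨h3, h4⟩ := key (d c) hn hc'
    refine comp_left_cancel h3 h1 (h4.trans ?_)
    conv_rhs => rw [← e]
    congr 1
    exact e2.symm

theorem rng_tail {x : PathSpace Λ} {b : Λ} (h : x.Starts b) :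
    (x.tail (d b) h.1).rng = s b := by
  rw [← ((starts_tail_iff h (s b)).2 ⟨(r_s b).symm, by rwa [comp_id]⟩).rng_eq, r_s]

/-- Given `a ∈ Λ` and a path `x` with `s(a) = r(x)`, there is a unique path `ax` of degree
`d(a) + d(x)` such that `(ax)(0, d(a) + n) = a x(0, n)` for all `n ≤ d(x)`. -/
theorem existsUnique_prepend (a : Λ) (x : PathSpace Λ) (h : s a = x.rng) :
    ∃! y : PathSpace Λ, (y.deg = fun i => (d a i : ℕ∞) + x.deg i) ∧
      ∀ n (hn : ∀ i, (n i : ℕ∞) ≤ x.deg i), y.Starts (comp a (x.seg 0 n zero_le hn)) := by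
  have hs : ∀ n (hn : ∀ i, (n i : ℕ∞) ≤ x.deg i), s a = r (x.seg 0 n zero_le hn) := fun n hn => by
    rw [h, (starts_seg x hn).rng_eq]
  have hdeg : ∀ n (hn : ∀ i, (n i : ℕ∞) ≤ x.deg i),
      d (comp a (x.seg 0 n zero_le hn)) = d a + n := fun n hn => by
    rw [d_comp _ _ (hs n hn), d_seg, tsub_zero]
  have hb : ∀ n : Fin k → ℕ, (∀ i, (n i : ℕ∞) ≤ (d a i : ℕ∞) + x.deg i) →
      ∀ i, ((n ⊔ d a - d a) i : ℕ∞) ≤ x.deg i := fun n hn i => by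
    have h1 : (n ⊔ d a - d a) i = n i - d a i := by
      simp only [Pi.sub_apply, Pi.sup_apply]
      omega
    rw [h1, ENat.natCast_sub]
    exact tsub_le_iff_left.mpr (hn i)
  have hsum : ∀ n : Fin k → ℕ, d a + (n ⊔ d a - d a) = n ⊔ d a := fun n =>
    add_tsub_cancel_of_le le_sup_right
  have hmono : ∀ n n' hn hn', n ≤ n' →
      Pre (comp a (x.seg 0 n zero_le hn)) (comp a (x.seg 0 n' zero_le hn')) := by
    intro n n' hn hn' hle
    refine ⟨x.seg n n' hle hn', ?_, ?_⟩
    · rw [s_comp _ _ (hs n hn)]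
      exact s_seg_eq x _ _ _ _
    · rw [assoc _ _ _ (hs n hn) (s_seg_eq x _ _ _ _), comp_seg]
  have hex : ∀ n (hn : ∀ i, (n i : ℕ∞) ≤ (d a i : ℕ∞) + x.deg i),
      ∃ b, Pre b (comp a (x.seg 0 (n ⊔ d a - d a) zero_le (hb n hn))) ∧ d b = n := fun n hn =>
    exists_pre (by rw [hdeg, hsum]; exact le_sup_left)
  choose f hf1 hf2 using hex
  obtain ⟨y, hy1, hy2⟩ := exists_of_prefixes (Λ := Λ) (fun i => (d a i : ℕ∞) + x.deg i) f hf2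
    (fun n hn n' hn' hle => ((hf1 n hn).trans (hmono _ _ _ _
      (tsub_le_tsub_right (sup_le_sup_right hle _) _))).of_le (hf1 n' hn')
        (by rw [hf2, hf2]; exact hle))
  have hy3 : ∀ n (hn : ∀ i, (n i : ℕ∞) ≤ x.deg i), y.Starts (comp a (x.seg 0 n zero_le hn)) := by
    intro n hn
    refine (hy2 _).2 ⟨?_, ?_⟩
    · intro i
      rw [hdeg]
      simpa using hn i
    · refine (hf1 _ _).eq ?_ (hf2 _ _)
      refine hmono _ _ _ _ ?_
      rw [hdeg, sup_of_le_left le_self_add, add_tsub_cancel_left]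
  have huniq : ∀ y y' : PathSpace Λ, (y.deg = fun i => (d a i : ℕ∞) + x.deg i) →
      (∀ n (hn : ∀ i, (n i : ℕ∞) ≤ x.deg i), y.Starts (comp a (x.seg 0 n zero_le hn))) →
      (∀ n (hn : ∀ i, (n i : ℕ∞) ≤ x.deg i), y'.Starts (comp a (x.seg 0 n zero_le hn))) →
      ∀ b, y.Starts b → y'.Starts b := by
    intro y y' h1 h2 h3 b hyb
    have hn := hb (d b) (fun i => by have := hyb.1 i; rwa [h1] at this)
    obtain ⟨e, he1, he2, he3⟩ := hyb.directed (h2 _ hn)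
    exact (h3 _ hn).pre (he2.of_le he3 (by rw [hdeg, hsum]; exact le_sup_left))
  refine ⟨y, ⟨hy1, hy3⟩, ?_⟩
  rintro y' ⟨h1, h2⟩
  exact ext_starts fun b => ⟨huniq y' y h1 h2 hy3 b, huniq y y' hy1 hy3 h2 b⟩

/-- The path `ax`, for `a ∈ Λ` and a path `x` with `s(a) = r(x)`. -/
noncomputable def prepend (a : Λ) (x : PathSpace Λ) (h : s a = x.rng) : PathSpace Λ :=
  (existsUnique_prepend a x h).choose

theorem starts_prepend_iff (a : Λ) (x : PathSpace Λ) (h : s a = x.rng) (b : Λ) :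
    (prepend a x h).Starts b ↔ ∃ c, x.Starts c ∧ Pre b (comp a c) := by
  obtain ⟨h1, h2⟩ := (existsUnique_prepend a x h).choose_spec.1
  change (prepend a x h).deg = _ at h1
  change ∀ n hn, (prepend a x h).Starts _ at h2
  constructor
  · intro hb
    have hn : ∀ i, ((d b - d a) i : ℕ∞) ≤ x.deg i := fun i => by
      have := hb.1 i
      rw [h1] at this
      rw [Pi.sub_apply, ENat.natCast_sub]
      exact tsub_le_iff_left.mpr this
    refine ⟨_, starts_seg x hn, ?_⟩
    obtain ⟨e, -, he2, he3⟩ := hb.directed (h2 _ hn)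
    refine he2.of_le he3 ?_
    rw [d_comp _ _ (by rw [h, (starts_seg x hn).rng_eq]), d_seg, tsub_zero]
    exact le_add_tsub
  · rintro ⟨c, hc, hb⟩
    refine Starts.pre ?_ hb
    have := h2 _ hc.1
    rwa [hc.2] at this

end PathSpace

/-! ### The inverse semigroup `S_Λ` -/

section Semigroup

variable {k : ℕ} {Λ : Type u} [KGraph k Λ]

/-- `Λ^min(a, b)`: the pairs `(α, β)` with `aα = bβ` and `d(aα) = d(a) ∨ d(b)`. -/
def minExt (a b : Λ) : Set (Λ × Λ) :=
  {p | s a = r p.1 ∧ s b = r p.2 ∧ comp a p.1 = comp b p.2 ∧ d (comp a p.1) = d a ⊔ d b}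

/-- `Λ` is finitely aligned if every `Λ^min(a, b)` is finite. -/
class FinitelyAligned {k : ℕ} (Λ : Type u) [KGraph k Λ] : Prop where
  finite : ∀ a b : Λ, (minExt a b).Finite

/-- The relation `(λ, μ) ⊥ (ξ, η)`. -/
def Perp (p q : Λ × Λ) : Prop := minExt p.1 q.1 = ∅ ∧ minExt p.2 q.2 = ∅

theorem exists_minExt {a b x y : Λ} (hx : s a = r x) (hy : s b = r y)
    (e : comp a x = comp b y) : ∃ p ∈ minExt a b, ∃ t, s p.1 = r t ∧ s p.2 = r t ∧
      x = comp p.1 t ∧ y = comp p.2 t := by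
  have ha := pre_comp hx
  have hb : Pre b (comp a x) := e ▸ pre_comp hy
  obtain ⟨f, hf, hd⟩ := exists_pre (sup_le ha.d_le hb.d_le)
  obtain ⟨α, h1, h2⟩ := ha.of_le hf (by rw [hd]; exact le_sup_left)
  obtain ⟨β, h3, h4⟩ := hb.of_le hf (by rw [hd]; exact le_sup_right)
  obtain ⟨t, h5, h6⟩ := hf
  have h7 : s α = r t := by rw [← h5, ← h2, s_comp _ _ h1]
  have h8 : s β = r t := by rw [← h5, ← h4, s_comp _ _ h3]
  refine ⟨(α, β), ⟨h1, h3, h2.trans h4.symm, by rw [h2, hd]⟩, t, h7, h8, ?_, ?_⟩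
  · refine comp_left_cancel hx (by rw [r_comp _ _ h7, h1]) ?_
    rw [← assoc _ _ _ h1 h7, h2, h6]
  · refine comp_left_cancel hy (by rw [r_comp _ _ h8, h3]) ?_
    rw [← assoc _ _ _ h3 h8, h4, h6, e]

theorem minExt_eq_empty {a b : Λ} (h : ∀ e, Pre a e → Pre b e → False) : minExt a b = ∅ := by
  refine Set.eq_empty_of_forall_notMem ?_
  rintro p ⟨h1, h2, h3, -⟩
  exact h _ (pre_comp h1) (h3 ▸ pre_comp h2)

theorem not_pre_of_minExt {a b e : Λ} (h : minExt a b = ∅) (h1 : Pre a e) (h2 : Pre b e) :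
    False := by
  obtain ⟨x, hx, hx'⟩ := h1
  obtain ⟨y, hy, hy'⟩ := h2
  obtain ⟨p, hp, -⟩ := exists_minExt hx hy (hx'.trans hy'.symm)
  rw [h] at hp
  exact hp

variable (Λ) in
/-- `S_Λ`: the finite sets `F` of pairs `(λ, μ) ∈ Λ × Λ` with `s(λ) = s(μ)`, any two distinct
elements of which satisfy `(λ, μ) ⊥ (ν, ω)`. -/
@[ext]
structure SLambda where
  carrier : Set (Λ × Λ)
  finite : carrier.Finite
  source_eq : ∀ p ∈ carrier, s p.1 = s p.2
  perp : ∀ p ∈ carrier, ∀ q ∈ carrier, p ≠ q → Perp p q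

namespace SLambda

/-- The relation on `Λ` given by all the pairs `(λτ, μτ)` with `(λ, μ) ∈ F`. -/
def Rel (F : SLambda Λ) (a b : Λ) : Prop :=
  ∃ p ∈ F.carrier, ∃ t, s p.1 = r t ∧ a = comp p.1 t ∧ b = comp p.2 t

theorem rel_of_mem {F : SLambda Λ} {p : Λ × Λ} (h : p ∈ F.carrier) : F.Rel p.1 p.2 :=
  ⟨p, h, s p.1, (r_s _).symm, (comp_id _).symm, by rw [F.source_eq p h, comp_id]⟩

theorem Rel.s_eq {F : SLambda Λ} {a b : Λ} (h : F.Rel a b) : s a = s b := by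
  obtain ⟨p, hp, t, ht, rfl, rfl⟩ := h
  rw [s_comp _ _ ht, s_comp _ _ (by rw [← F.source_eq p hp, ht])]

theorem Rel.comp {F : SLambda Λ} {a b c : Λ} (h : F.Rel a b) (hc : s a = r c) :
    F.Rel (comp a c) (comp b c) := by
  obtain ⟨p, hp, t, ht, rfl, rfl⟩ := h
  have ht' : s p.2 = r t := by rw [← F.source_eq p hp, ht]
  rw [s_comp _ _ ht] at hc
  exact ⟨p, hp, KGraph.comp t c, by rw [r_comp _ _ hc, ht], assoc _ _ _ ht hc, assoc _ _ _ ht' hc⟩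

theorem Rel.left_unique {F : SLambda Λ} {a a' b : Λ} (h : F.Rel a b) (h' : F.Rel a' b) :
    a = a' := by
  obtain ⟨p, hp, t, ht, rfl, rfl⟩ := h
  obtain ⟨p', hp', t', ht', rfl, e⟩ := h'
  have h1 : s p.2 = r t := by rw [← F.source_eq p hp, ht]
  have h2 : s p'.2 = r t' := by rw [← F.source_eq p' hp', ht']
  by_cases hpp : p = p'
  · subst hpp
    rw [comp_left_cancel h1 h2 e]
  · exact (not_pre_of_minExt (F.perp p hp p' hp' hpp).2 (pre_comp h1) (e ▸ pre_comp h2)).elim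

theorem Rel.right_unique {F : SLambda Λ} {a b b' : Λ} (h : F.Rel a b) (h' : F.Rel a b') :
    b = b' := by
  obtain ⟨p, hp, t, ht, rfl, rfl⟩ := h
  obtain ⟨p', hp', t', ht', e, rfl⟩ := h'
  by_cases hpp : p = p'
  · subst hpp
    rw [comp_left_cancel ht ht' e]
  · exact (not_pre_of_minExt (F.perp p hp p' hp' hpp).1 (pre_comp ht) (e ▸ pre_comp ht')).elim

theorem Rel.right_pre {F : SLambda Λ} {a b b' : Λ} (h : F.Rel a b) (hb : Pre b b') :
    ∃ a', Pre a a' ∧ F.Rel a' b' := by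
  obtain ⟨c, hc, rfl⟩ := hb
  have hc' : s a = r c := by rw [h.s_eq, hc]
  exact ⟨KGraph.comp a c, pre_comp hc', h.comp hc'⟩

theorem subset_of_rel {F G : SLambda Λ} (h : ∀ a b, F.Rel a b ↔ G.Rel a b) :
    F.carrier ⊆ G.carrier := by
  intro p hp
  obtain ⟨q, hq, t, ht, h1, h2⟩ := (h _ _).1 (rel_of_mem hp)
  obtain ⟨p', hp', t', ht', h3, h4⟩ := (h _ _).2 (rel_of_mem hq)
  have hpre : Pre p'.1 p.1 := by
    rw [h1]
    exact Pre.trans (h3 ▸ pre_comp ht') (pre_comp ht)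
  have hpp : p = p' := by
    by_contra hne
    exact not_pre_of_minExt (F.perp p hp p' hp' hne).1 (Pre.refl _) hpre
  subst hpp
  have hd : d t = 0 := by
    have e1 := congrArg d h1
    have e2 := congrArg d h3
    rw [d_comp _ _ ht] at e1
    rw [d_comp _ _ ht'] at e2
    funext i
    have e1 := congrFun e1 i
    have e2 := congrFun e2 i
    simp only [Pi.add_apply, Pi.zero_apply] at *
    omega
  have ht2 : s q.2 = r t := by rw [← G.source_eq q hq, ht]
  have : p = q := Prod.ext (by rw [h1, eq_s_of_d ht hd, comp_id])
    (by rw [h2, eq_s_of_d ht2 hd, comp_id])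
  rwa [this]

theorem ext_rel {F G : SLambda Λ} (h : ∀ a b, F.Rel a b ↔ G.Rel a b) : F = G :=
  SLambda.ext ((subset_of_rel h).antisymm (subset_of_rel fun a b => (h a b).symm))

/-- The involution `F* = {(μ, λ) : (λ, μ) ∈ F}`. -/
instance : Star (SLambda Λ) where
  star F :=
    { carrier := {p | (p.2, p.1) ∈ F.carrier}
      finite := F.finite.preimage (f := Prod.swap) Prod.swap_injective.injOn
      source_eq := fun _ hp => (F.source_eq _ hp).symm
      perp := fun _ hp _ hq hne => (F.perp _ hp _ hq fun e => hne
        (Prod.ext (congrArg Prod.snd e) (congrArg Prod.fst e))).symm }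

theorem star_rel {F : SLambda Λ} {a b : Λ} : (star F).Rel a b ↔ F.Rel b a := by
  constructor
  · rintro ⟨p, hp, t, ht, h1, h2⟩
    exact ⟨_, hp, t, by rw [← ht]; exact F.source_eq _ hp, h2, h1⟩
  · rintro ⟨p, hp, t, ht, h1, h2⟩
    exact ⟨(p.2, p.1), hp, t, by rw [← ht]; exact (F.source_eq _ hp).symm, h2, h1⟩

/-- The singleton `{(λ, μ)}`, where `s(λ) = s(μ)`. -/
def single (a b : Λ) (h : s a = s b) : SLambda Λ where
  carrier := {(a, b)}
  finite := Set.finite_singleton _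
  source_eq := by rintro _ rfl; exact h
  perp := by rintro _ rfl _ rfl hne; exact (hne rfl).elim

theorem single_rel {a b : Λ} (h : s a = s b) {e f : Λ} : (single a b h).Rel e f ↔
    ∃ t, s a = r t ∧ e = KGraph.comp a t ∧ f = KGraph.comp b t := by
  constructor
  · rintro ⟨p, rfl, hp⟩
    exact hp
  · intro hp
    exact ⟨_, rfl, hp⟩

variable [FinitelyAligned Λ]

/-- The product `FG = ⋃ {(λα, ηβ) : (α, β) ∈ Λ^min(μ, ξ)}`, the union being over `(λ, μ) ∈ F` and
`(ξ, η) ∈ G`. -/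
instance : Mul (SLambda Λ) where
  mul F G :=
    { carrier := ⋃ p ∈ F.carrier, ⋃ q ∈ G.carrier,
        (fun t : Λ × Λ => (KGraph.comp p.1 t.1, KGraph.comp q.2 t.2)) '' minExt p.2 q.1
      finite := F.finite.biUnion fun p _ => G.finite.biUnion fun q _ =>
        (FinitelyAligned.finite _ _).image _
      source_eq := by
        intro x hx
        simp only [Set.mem_iUnion, Set.mem_image] at hx
        obtain ⟨p, hp, q, hq, t, ⟨h1, h2, h3, -⟩, rfl⟩ := hx
        have e := congrArg s h3
        rw [s_comp _ _ h1, s_comp _ _ h2] at e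
        show s (KGraph.comp p.1 t.1) = s (KGraph.comp q.2 t.2)
        rw [s_comp _ _ (by rw [F.source_eq p hp, h1]), s_comp _ _ (by rw [← G.source_eq q hq, h2]),
          e]
      perp := by
        intro x hx y hy hne
        simp only [Set.mem_iUnion, Set.mem_image] at hx hy
        obtain ⟨p, hp, q, hq, t, ⟨h1, h2, h3, h4⟩, rfl⟩ := hx
        obtain ⟨p', hp', q', hq', t', ⟨h1', h2', h3', h4'⟩, rfl⟩ := hy
        have g1 : s p.1 = r t.1 := by rw [F.source_eq p hp, h1]
        have g2 : s q.2 = r t.2 := by rw [← G.source_eq q hq, h2]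
        have g1' : s p'.1 = r t'.1 := by rw [F.source_eq p' hp', h1']
        have g2' : s q'.2 = r t'.2 := by rw [← G.source_eq q' hq', h2']
        have R1 : F.Rel (KGraph.comp p.1 t.1) (KGraph.comp p.2 t.1) := (rel_of_mem hp).comp g1
        have R1' : F.Rel (KGraph.comp p'.1 t'.1) (KGraph.comp p'.2 t'.1) :=
          (rel_of_mem hp').comp g1'
        have R2 : G.Rel (KGraph.comp q.1 t.2) (KGraph.comp q.2 t.2) := (rel_of_mem hq).comp h2
        have R2' : G.Rel (KGraph.comp q'.1 t'.2) (KGraph.comp q'.2 t'.2) :=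
          (rel_of_mem hq').comp h2'
        -- the middle paths have no common extension
        have mid : ∀ e, Pre (KGraph.comp p.2 t.1) e → Pre (KGraph.comp p'.2 t'.1) e → False := by
          intro e he he'
          have hpp : p = p' := by
            by_contra hc
            exact not_pre_of_minExt (F.perp _ hp _ hp' hc).2 ((pre_comp h1).trans he)
              ((pre_comp h1').trans he')
          have hqq : q = q' := by
            by_contra hc
            rw [h3] at he
            rw [h3'] at he'
            exact not_pre_of_minExt (G.perp _ hq _ hq' hc).1 ((pre_comp h2).trans he)
              ((pre_comp h2').trans he')
          subst hpp
          subst hqq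
          have e1 : KGraph.comp p.2 t.1 = KGraph.comp p.2 t'.1 := he.eq he' (by rw [h4, h4'])
          have e2 := comp_left_cancel h1 h1' e1
          have e3 := comp_left_cancel h2 h2' (by rw [← h3, ← h3', e1])
          exact hne (by rw [e2, e3])
        constructor
        · refine minExt_eq_empty fun e he he' => ?_
          have S1 := star_rel.2 R1
          have S1' := star_rel.2 R1'
          obtain ⟨f, hf, hf'⟩ := S1.right_pre he
          obtain ⟨f', hf2, hf2'⟩ := S1'.right_pre he'
          rw [hf'.left_unique hf2'] at hf
          exact mid _ hf hf2
        · refine minExt_eq_empty fun e he he' => ?_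
          obtain ⟨f, hf, hf'⟩ := R2.right_pre he
          obtain ⟨f', hf2, hf2'⟩ := R2'.right_pre he'
          rw [hf'.left_unique hf2', ← h3] at hf
          rw [← h3'] at hf2
          exact mid _ hf hf2 }

theorem mem_mul {F G : SLambda Λ} {x : Λ × Λ} : x ∈ (F * G).carrier ↔
    ∃ p ∈ F.carrier, ∃ q ∈ G.carrier, ∃ t ∈ minExt p.2 q.1,
      (KGraph.comp p.1 t.1, KGraph.comp q.2 t.2) = x := by
  change x ∈ (⋃ p ∈ F.carrier, ⋃ q ∈ G.carrier, _) ↔ _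
  simp only [Set.mem_iUnion, Set.mem_image, exists_prop]

theorem mul_rel {F G : SLambda Λ} {a c : Λ} : (F * G).Rel a c ↔ ∃ b, F.Rel a b ∧ G.Rel b c := by
  constructor
  · rintro ⟨x, hx, t, ht, rfl, rfl⟩
    obtain ⟨p, hp, q, hq, u, ⟨h1, h2, h3, -⟩, rfl⟩ := mem_mul.1 hx
    have g1 : s p.1 = r u.1 := by rw [F.source_eq p hp, h1]
    have R1 := (rel_of_mem hp).comp g1
    have R2 := (rel_of_mem hq).comp h2
    refine ⟨_, R1.comp ht, ?_⟩
    rw [h3]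
    refine R2.comp ?_
    rw [← h3, ← R1.s_eq, ht]
  · rintro ⟨b, ⟨p, hp, t, ht, rfl, rfl⟩, ⟨q, hq, t', ht', e, rfl⟩⟩
    obtain ⟨u, hu, w, h1, h2, rfl, rfl⟩ :=
      exists_minExt (by rw [← F.source_eq p hp, ht]) ht' e
    have g1 : s p.1 = r u.1 := by rw [ht, r_comp _ _ h1]
    have g2 : s q.2 = r u.2 := by rw [← G.source_eq q hq, ht', r_comp _ _ h2]
    refine ⟨_, mem_mul.2 ⟨p, hp, q, hq, u, hu, rfl⟩, w, ?_, ?_, ?_⟩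
    · show s (KGraph.comp p.1 u.1) = _
      rw [s_comp _ _ g1, h1]
    · exact (assoc _ _ _ g1 h1).symm
    · exact (assoc _ _ _ g2 h2).symm

noncomputable instance : Semigroup (SLambda Λ) where
  mul_assoc F G H := ext_rel fun a b => by
    simp only [mul_rel]
    constructor
    · rintro ⟨c, ⟨e, h1, h2⟩, h3⟩
      exact ⟨e, h1, c, h2, h3⟩
    · rintro ⟨e, h1, c, h2, h3⟩
      exact ⟨c, ⟨e, h1, h2⟩, h3⟩

theorem rel_idem {P : SLambda Λ} (hP : P * P = P) {a b : Λ} (h : P.Rel a b) : a = b := by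
  have h' := h
  rw [← hP] at h'
  obtain ⟨c, h1, h2⟩ := mul_rel.1 h'
  rw [← h2.left_unique h, h1.right_unique h]

theorem single_idem (a : Λ) : single a a rfl * single a a rfl = single a a rfl := by
  refine ext_rel fun e f => ?_
  simp only [mul_rel, single_rel]
  constructor
  · rintro ⟨b, ⟨t, h1, rfl, rfl⟩, ⟨t', h2, h3, rfl⟩⟩
    exact ⟨t, h1, rfl, h3.symm⟩
  · rintro ⟨t, h1, rfl, rfl⟩
    exact ⟨_, ⟨t, h1, rfl, rfl⟩, t, h1, rfl, rfl⟩

end SLambda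

end Semigroup

/-! ### The action `θ` of `S_Λ` on `X_Λ` -/

section Action

variable {k : ℕ} {Λ : Type u} [KGraph k Λ]

open SLambda PathSpace

/-- `D_F`: the paths `x` such that `x(0, d(μ)) = μ` for some `(λ, μ) ∈ F`. -/
def dom (F : SLambda Λ) : Set (PathSpace Λ) :=
  {x | ∃ p ∈ F.carrier, x.Starts p.2}

/-- The topology of `X_Λ`, with subbasis the sets `D_F` and their complements. -/
instance : TopologicalSpace (PathSpace Λ) :=
  TopologicalSpace.generateFrom {U | ∃ F : SLambda Λ, U = dom F ∨ U = (dom F)ᶜ}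

/-- `θ_F(x) = λ x(d(μ), d(x))`, where `(λ, μ)` is the element of `F` with `x(0, d(μ)) = μ`. -/
noncomputable def theta (F : SLambda Λ) (x : PathSpace Λ) (hx : x ∈ dom F) : PathSpace Λ :=
  prepend hx.choose.1 (x.tail (d hx.choose.2) hx.choose_spec.2.1)
    ((F.source_eq _ hx.choose_spec.1).trans (rng_tail hx.choose_spec.2).symm)

theorem mem_unique {F : SLambda Λ} {x : PathSpace Λ} {p q : Λ × Λ} (hp : p ∈ F.carrier)
    (hq : q ∈ F.carrier) (hxp : x.Starts p.2) (hxq : x.Starts q.2) : p = q := by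
  by_contra hne
  obtain ⟨e, -, h1, h2⟩ := hxp.directed hxq
  exact not_pre_of_minExt (F.perp _ hp _ hq hne).2 h1 h2

/-- `θ_F(x)` does not depend on a choice. -/
theorem theta_eq {F : SLambda Λ} {x : PathSpace Λ} (hx : x ∈ dom F) {p : Λ × Λ}
    (hp : p ∈ F.carrier) (hxp : x.Starts p.2) :
    theta F x hx = prepend p.1 (x.tail (d p.2) hxp.1)
      ((F.source_eq _ hp).trans (rng_tail hxp).symm) := by
  obtain rfl := mem_unique hp hx.choose_spec.1 hxp hx.choose_spec.2
  rfl

theorem mem_dom_iff {F : SLambda Λ} {x : PathSpace Λ} :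
    x ∈ dom F ↔ ∃ a b, F.Rel a b ∧ x.Starts b := by
  constructor
  · rintro ⟨p, hp, h⟩
    exact ⟨_, _, rel_of_mem hp, h⟩
  · rintro ⟨a, b, ⟨p, hp, t, ht, rfl, rfl⟩, h⟩
    exact ⟨p, hp, h.pre (pre_comp (by rw [← F.source_eq p hp, ht]))⟩

theorem starts_theta_iff {F : SLambda Λ} {x : PathSpace Λ} (hx : x ∈ dom F) (e : Λ) :
    (theta F x hx).Starts e ↔ ∃ a b, F.Rel a b ∧ x.Starts b ∧ Pre e a := by
  constructor
  · have hx' := hx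
    obtain ⟨p, hp, hxp⟩ := hx'
    rw [theta_eq hx hp hxp, starts_prepend_iff]
    rintro ⟨c, hc, he⟩
    obtain ⟨h1, h2⟩ := (starts_tail_iff hxp c).1 hc
    exact ⟨_, _, (rel_of_mem hp).comp ((F.source_eq p hp).trans h1), h2, he⟩
  · rintro ⟨a, b, ⟨p, hp, t, ht, rfl, rfl⟩, hb, he⟩
    have ht' : s p.2 = r t := by rw [← F.source_eq p hp, ht]
    have hxp := hb.pre (pre_comp ht')
    rw [theta_eq _ hp hxp, starts_prepend_iff]
    exact ⟨t, (starts_tail_iff hxp t).2 ⟨ht', hb⟩, he⟩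

theorem theta_mem_dom_star {F : SLambda Λ} {x : PathSpace Λ} (hx : x ∈ dom F) :
    theta F x hx ∈ dom (star F) := by
  obtain ⟨a, b, h1, h2⟩ := mem_dom_iff.1 hx
  exact mem_dom_iff.2 ⟨b, a, star_rel.2 h1, (starts_theta_iff hx a).2 ⟨a, b, h1, h2, Pre.refl a⟩⟩

theorem theta_star_theta {F : SLambda Λ} {x : PathSpace Λ} (hx : x ∈ dom F)
    (h : theta F x hx ∈ dom (star F)) : theta (star F) (theta F x hx) h = x := by
  refine ext_starts fun e => ?_
  simp only [starts_theta_iff, star_rel]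
  constructor
  · rintro ⟨b, a, h1, ⟨a', b', h2, h3, h4⟩, h5⟩
    obtain ⟨b'', h6, h7⟩ := (star_rel.2 h1).right_pre h4
    rw [star_rel] at h7
    rw [h7.right_unique h2] at h6
    exact h3.pre (h5.trans h6)
  · intro he
    obtain ⟨a, b, h1, h2⟩ := mem_dom_iff.1 hx
    obtain ⟨f, h3, h4, h5⟩ := he.directed h2
    obtain ⟨a', -, h6⟩ := h1.right_pre h5
    exact ⟨f, a', h6, ⟨a', f, h6, h3, Pre.refl _⟩, h4⟩

theorem theta_congr {F G : SLambda Λ} {x : PathSpace Λ} (hx : x ∈ dom F) (hy : x ∈ dom G)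
    (h : ∃ a b, F.Rel a b ∧ G.Rel a b ∧ x.Starts b) : theta F x hx = theta G x hy := by
  obtain ⟨a, b, h1, h2, h3⟩ := h
  have key : ∀ (F G : SLambda Λ) (hx : x ∈ dom F) (hy : x ∈ dom G), F.Rel a b → G.Rel a b →
      ∀ e, (theta F x hx).Starts e → (theta G x hy).Starts e := by
    intro F G hx hy hF hG e he
    rw [starts_theta_iff] at he ⊢
    obtain ⟨a', b', h4, h5, h6⟩ := he
    obtain ⟨g, h7, h8, h9⟩ := h3.directed h5
    obtain ⟨c, hc, rfl⟩ := h8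
    obtain ⟨a'', h10, h11⟩ := h4.right_pre h9
    have hc' := hF.s_eq.trans hc
    rw [h11.left_unique (hF.comp hc')] at h10
    exact ⟨_, _, hG.comp hc', h7, h6.trans h10⟩
  exact ext_starts fun e => ⟨key F G hx hy h1 h2 e, key G F hy hx h2 h1 e⟩

variable [FinitelyAligned Λ]

theorem mem_dom_mul {F G : SLambda Λ} {x : PathSpace Λ} (hx : x ∈ dom G)
    (h : theta G x hx ∈ dom F) : x ∈ dom (F * G) := by
  obtain ⟨a, b, h1, h2⟩ := mem_dom_iff.1 h
  obtain ⟨c, f, h3, h4, h5⟩ := (starts_theta_iff hx b).1 h2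
  obtain ⟨a', -, h6⟩ := h1.right_pre h5
  exact mem_dom_iff.2 ⟨a', f, mul_rel.2 ⟨c, h6, h3⟩, h4⟩

theorem theta_mul {F G : SLambda Λ} {x : PathSpace Λ} (hx : x ∈ dom G)
    (h : theta G x hx ∈ dom F) (h' : x ∈ dom (F * G)) :
    theta (F * G) x h' = theta F (theta G x hx) h := by
  refine ext_starts fun e => ?_
  simp only [starts_theta_iff, mul_rel]
  constructor
  · rintro ⟨a, c, ⟨b, h1, h2⟩, h3, h4⟩
    exact ⟨a, b, h1, ⟨b, c, h2, h3, Pre.refl _⟩, h4⟩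
  · rintro ⟨a, b, h1, ⟨c, f, h2, h3, h4⟩, h5⟩
    obtain ⟨a', h6, h7⟩ := h1.right_pre h4
    exact ⟨a', f, ⟨c, h7, h2⟩, h3, h5.trans h6⟩

/-! ### The groupoid of germs -/

variable (Λ) in
/-- `Ξ_Λ`: the pairs `(F, x)` with `F ∈ S_Λ` and `x ∈ D_F`. -/
def Xi : Type u := {p : SLambda Λ × PathSpace Λ // p.2 ∈ dom p.1}

/-- `(F, x) ∼ (G, y)` iff `x = y` and `FP = GP` for some idempotent `P ∈ S_Λ` with `x ∈ D_P`. -/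
def GermRel (p q : Xi Λ) : Prop :=
  p.1.2 = q.1.2 ∧ ∃ P : SLambda Λ, P * P = P ∧ p.1.2 ∈ dom P ∧ p.1.1 * P = q.1.1 * P

theorem germRel_iff (p q : Xi Λ) : GermRel p q ↔ p.1.2 = q.1.2 ∧
    ∃ a b, p.1.1.Rel a b ∧ q.1.1.Rel a b ∧ p.1.2.Starts b := by
  refine and_congr_right fun _ => ?_
  constructor
  · rintro ⟨P, hP, hx, e⟩
    obtain ⟨a, b, h1, h2⟩ := mem_dom_iff.1 p.2
    obtain ⟨c, f, h3, h4⟩ := mem_dom_iff.1 hx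
    obtain ⟨g, h5, h6, h7⟩ := h2.directed h4
    obtain ⟨a', -, h8⟩ := h1.right_pre h6
    obtain ⟨c', -, h9⟩ := h3.right_pre h7
    obtain rfl := rel_idem hP h9
    have h10 : (p.1.1 * P).Rel a' c' := mul_rel.2 ⟨c', h8, h9⟩
    rw [e] at h10
    obtain ⟨m, h11, h12⟩ := mul_rel.1 h10
    obtain rfl := rel_idem hP h12
    exact ⟨a', m, h8, h11, h5⟩
  · rintro ⟨a, b, h1, h2, h3⟩
    refine ⟨single b b rfl, single_idem b, ⟨(b, b), rfl, h3⟩, ?_⟩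
    have key : ∀ F G : SLambda Λ, F.Rel a b → G.Rel a b → ∀ e f,
        (F * single b b rfl).Rel e f → (G * single b b rfl).Rel e f := by
      intro F G hF hG e f h
      simp only [mul_rel, single_rel] at h ⊢
      obtain ⟨m, h4, t, h5, rfl, rfl⟩ := h
      have hat : s a = r t := by rw [hF.s_eq, h5]
      rw [h4.left_unique (hF.comp hat)]
      exact ⟨_, hG.comp hat, t, h5, rfl, rfl⟩
    exact ext_rel fun e f => ⟨key _ _ h1 h2 e f, key _ _ h2 h1 e f⟩

variable (Λ) in
/-- The germ relation is an equivalence relation. -/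
instance germSetoid : Setoid (Xi Λ) where
  r := GermRel
  iseqv :=
    { refl := fun p => by
        obtain ⟨a, b, h1, h2⟩ := mem_dom_iff.1 p.2
        exact (germRel_iff p p).2 ⟨rfl, a, b, h1, h1, h2⟩
      symm := by
        rintro p q ⟨h1, P, h2, h3, h4⟩
        exact ⟨h1.symm, P, h2, h1 ▸ h3, h4.symm⟩
      trans := by
        intro p q t h1 h2
        obtain ⟨e1, a, b, h3, h4, h5⟩ := (germRel_iff _ _).1 h1
        obtain ⟨e2, a', b', h6, h7, h8⟩ := (germRel_iff _ _).1 h2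
        rw [← e1] at h8
        obtain ⟨g, h9, h10, h11⟩ := h5.directed h8
        obtain ⟨c, hc, rfl⟩ := h10
        obtain ⟨c', hc', e⟩ := h11
        have i1 := h3.comp (h3.s_eq.trans hc)
        have i2 := h4.comp (h3.s_eq.trans hc)
        have i3 := h6.comp (h6.s_eq.trans hc')
        have i4 := h7.comp (h6.s_eq.trans hc')
        rw [e] at i3 i4
        rw [i3.left_unique i2] at i4
        exact (germRel_iff _ _).2 ⟨e1.trans e2, _, _, i1, i4, h9⟩ }

variable (Λ) in
/-- `𝒢_Λ`: the set of germs. -/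
def Germ : Type u := Quotient (germSetoid Λ)

/-- The germ `[F, x]`. -/
def germ (F : SLambda Λ) (x : PathSpace Λ) (hx : x ∈ dom F) : Germ Λ :=
  Quotient.mk (germSetoid Λ) ⟨(F, x), hx⟩

theorem germ_eq_iff {F G : SLambda Λ} {x y : PathSpace Λ} (hx : x ∈ dom F) (hy : y ∈ dom G) :
    germ F x hx = germ G y hy ↔ x = y ∧ ∃ a b, F.Rel a b ∧ G.Rel a b ∧ x.Starts b :=
  Quotient.eq.trans (germRel_iff _ _)

namespace Germ

/-- The source `s([F, x]) = x`, as an element of `X_Λ`. -/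
def src : Germ Λ → PathSpace Λ :=
  Quotient.lift (fun p : Xi Λ => p.1.2) fun _ _ h => h.1

/-- The range `r([F, x]) = θ_F(x)`, as an element of `X_Λ`. -/
noncomputable def rng : Germ Λ → PathSpace Λ :=
  Quotient.lift (fun p : Xi Λ => theta p.1.1 p.1.2 p.2) <| by
    rintro ⟨⟨F, x⟩, hx⟩ ⟨⟨G, y⟩, hy⟩ h
    obtain ⟨e, h⟩ := (germRel_iff _ _).1 h
    obtain rfl : x = y := e
    exact theta_congr _ _ h

@[simp]
theorem src_germ (F : SLambda Λ) (x : PathSpace Λ) (hx : x ∈ dom F) : src (germ F x hx) = x := rfl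

@[simp]
theorem rng_germ (F : SLambda Λ) (x : PathSpace Λ) (hx : x ∈ dom F) :
    rng (germ F x hx) = theta F x hx := rfl

theorem exists_rep (g : Germ Λ) : ∃ F x hx, g = germ F x hx := by
  obtain ⟨⟨⟨F, x⟩, hx⟩, rfl⟩ := Quotient.exists_rep g
  exact ⟨F, x, hx, rfl⟩

theorem exists_rep_out (g : Germ Λ) :
    ∃ F, ∃ hx : g.src ∈ dom F, g = germ F g.src hx := by
  obtain ⟨F, x, hx, rfl⟩ := exists_rep g
  exact ⟨F, hx, rfl⟩

/-- The product of composable germs, computed on representatives. By `mul_germ` it is given by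
`[F, θ_G(x)] [G, x] = [FG, x]` for all representatives. -/
noncomputable def mul (g h : Germ Λ) (c : g.src = h.rng) : Germ Λ :=
  germ (g.exists_rep_out.choose * h.exists_rep_out.choose) h.src <| by
    have hh := h.exists_rep_out.choose_spec
    refine mem_dom_mul hh.choose ?_
    have e := congrArg rng hh.choose_spec
    rw [rng_germ] at e
    rw [← e, ← c]
    exact g.exists_rep_out.choose_spec.choose

theorem mul_germ (F G : SLambda Λ) (x y : PathSpace Λ) (hx : x ∈ dom G) (hy : y ∈ dom F)
    (c : y = theta G x hx) : mul (germ F y hy) (germ G x hx) c =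
      germ (F * G) x (mem_dom_mul hx (c ▸ hy)) := by
  subst c
  unfold mul
  generalize_proofs p1 p2 p3 p4
  obtain ⟨q1, e1⟩ := p1.choose_spec
  obtain ⟨q2, e2⟩ := p2.choose_spec
  generalize p1.choose = F' at *
  generalize p2.choose = G' at *
  obtain ⟨-, a, b, h1, h2, h3⟩ := (germ_eq_iff _ _).1 e1
  obtain ⟨-, a', b', h4, h5, h6⟩ := (germ_eq_iff _ _).1 e2
  rw [src_germ] at *
  refine (germ_eq_iff _ _).2 ⟨rfl, ?_⟩
  obtain ⟨m, n, h7, h8, h9⟩ := (starts_theta_iff hx b).1 h3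
  obtain ⟨f, h10, h11, h12⟩ := h6.directed h8
  obtain ⟨t, ht, rfl⟩ := h11
  have ht' := h4.s_eq.trans ht
  obtain ⟨m', h13, h14⟩ := h7.right_pre h12
  rw [h14.left_unique (h4.comp ht')] at h13
  obtain ⟨w, hw, e⟩ := h9.trans h13
  have hw' := h1.s_eq.trans hw
  have i1 := h1.comp hw'
  have i2 := h2.comp hw'
  rw [e] at i1 i2
  exact ⟨_, _, mul_rel.2 ⟨_, i2, h5.comp ht'⟩, mul_rel.2 ⟨_, i1, h4.comp ht'⟩, h10⟩

/-- The inverse `[F, x]⁻¹ = [F*, θ_F(x)]`. -/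
noncomputable def inv : Germ Λ → Germ Λ :=
  Quotient.lift (fun p : Xi Λ => germ (star p.1.1) (theta p.1.1 p.1.2 p.2)
    (theta_mem_dom_star p.2)) <| by
    rintro ⟨⟨F, x⟩, hx⟩ ⟨⟨G, y⟩, hy⟩ h
    obtain ⟨e, h⟩ := (germRel_iff _ _).1 h
    obtain rfl : x = y := e
    refine (germ_eq_iff _ _).2 ⟨theta_congr _ _ h, ?_⟩
    obtain ⟨a, b, h1, h2, h3⟩ := h
    exact ⟨b, a, star_rel.2 h1, star_rel.2 h2,
      (starts_theta_iff hx a).2 ⟨a, b, h1, h3, Pre.refl a⟩⟩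

theorem inv_germ (F : SLambda Λ) (x : PathSpace Λ) (hx : x ∈ dom F) :
    inv (germ F x hx) = germ (star F) (theta F x hx) (theta_mem_dom_star hx) := rfl

theorem src_inv (g : Germ Λ) : src (inv g) = rng g := by
  obtain ⟨F, x, hx, rfl⟩ := exists_rep g
  rfl

theorem rng_inv (g : Germ Λ) : rng (inv g) = src g := by
  obtain ⟨F, x, hx, rfl⟩ := exists_rep g
  exact theta_star_theta hx _

theorem src_mul (g h : Germ Λ) (c : g.src = h.rng) : src (mul g h c) = src h := rfl

theorem rng_mul (g h : Germ Λ) (c : g.src = h.rng) : rng (mul g h c) = rng g := by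
  obtain ⟨F, y, hy, rfl⟩ := exists_rep g
  obtain ⟨G, x, hx, rfl⟩ := exists_rep h
  obtain rfl : y = theta G x hx := c
  rw [mul_germ]
  exact theta_mul hx hy _

end Germ

end Action

end KGraph

/-! ### Groupoids -/

/-- A groupoid in the "arrows only" presentation: a set `G` with a partially defined product and an
inversion. `Comp g h` says that the pair `(g, h)` is composable, that is, `(g, h) ∈ G⁽²⁾`. -/
class ArrowGroupoid (G : Type u) where
  Comp : G → G → Prop
  mul : ∀ g h : G, Comp g h → G
  inv : G → G
  inv_inv : ∀ g, inv (inv g) = g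
  assoc : ∀ g h l (hgh : Comp g h) (hhl : Comp h l),
    ∃ (h₁ : Comp (mul g h hgh) l) (h₂ : Comp g (mul h l hhl)),
      mul (mul g h hgh) l h₁ = mul g (mul h l hhl) h₂
  comp_inv : ∀ g, Comp g (inv g)
  inv_mul_cancel : ∀ g h (hgh : Comp g h),
    ∃ h₁ : Comp (inv g) (mul g h hgh), mul (inv g) (mul g h hgh) h₁ = h
  mul_inv_cancel : ∀ g h (hgh : Comp g h),
    ∃ h₁ : Comp (mul g h hgh) (inv h), mul (mul g h hgh) (inv h) h₁ = g

namespace ArrowGroupoid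

section

variable (G : Type u) [ArrowGroupoid G]

/-- The unit space `G⁽⁰⁾`: the set of all `g g⁻¹`, which is also the set of all `g⁻¹ g`. -/
def unitSpace : Set G := {e | ∃ g : G, e = mul g (inv g) (comp_inv g)}

variable {G}

theorem comp_inv_left (g : G) : Comp (inv g) g := by
  have := comp_inv (inv g)
  rwa [inv_inv] at this

theorem inv_mul_mem_unitSpace (g : G) : mul (inv g) g (comp_inv_left g) ∈ unitSpace G :=
  ⟨inv g, by simp only [inv_inv]⟩

/-- The range map `r(g) = g g⁻¹`. -/
def rangeMap (g : G) : unitSpace G := ⟨mul g (inv g) (comp_inv g), g, rfl⟩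

/-- The source map `s(g) = g⁻¹ g`. -/
def sourceMap (g : G) : unitSpace G := ⟨mul (inv g) g (comp_inv_left g), inv_mul_mem_unitSpace g⟩

/-- The product `AB` of two subsets of a groupoid: all products `gh` with `g ∈ A`, `h ∈ B` and
`(g, h)` composable. -/
def setMul (A B : Set G) : Set G := {l | ∃ g ∈ A, ∃ h ∈ B, ∃ c : Comp g h, l = mul g h c}

/-- The inverse `A⁻¹ = {g⁻¹ : g ∈ A}` of a subset of a groupoid. -/
def setInv (A : Set G) : Set G := inv '' A

end

section

variable (G : Type u) [ArrowGroupoid G] [TopologicalSpace G]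

/-- A topological groupoid: the product is continuous on the space of composable pairs (a subspace
of `G × G`), and inversion is continuous. -/
structure IsTopologicalGroupoid : Prop where
  continuous_mul : Continuous fun p : {p : G × G // Comp p.1 p.2} => mul p.1.1 p.1.2 p.2
  continuous_inv : Continuous (inv : G → G)

/-- `G^{op}`, the open bisections: the open Hausdorff subsets `A` of `G` on which `r` and `s`
restrict to homeomorphisms onto open subsets of `G⁽⁰⁾`. -/
def openBisections : Set (Set G) :=
  {A | IsOpen A ∧ T2Space A ∧
    Topology.IsOpenEmbedding (fun g : A => rangeMap (g : G)) ∧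
    Topology.IsOpenEmbedding (fun g : A => sourceMap (g : G))}

/-- `Gᵃ`, the compact open bisections. -/
def compactOpenBisections : Set (Set G) := {A | A ∈ openBisections G ∧ IsCompact A}

/-- `G` is an ample groupoid: a locally compact topological groupoid that is `r`-discrete (its unit
space is open) and in which the compact open bisections form a basis of the topology. -/
structure IsAmple : Prop where
  topological : IsTopologicalGroupoid G
  locallyCompact : LocallyCompactSpace G
  isOpen_unitSpace : IsOpen (unitSpace G)
  isBasis : TopologicalSpace.IsTopologicalBasis (compactOpenBisections G)

end

end ArrowGroupoid

namespace KGraph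

section GermGroupoid

variable {k : ℕ} {Λ : Type u} [KGraph k Λ] [FinitelyAligned Λ]

open SLambda PathSpace

/-- The groupoid of germs: `[F, θ_G(x)] [G, x] = [FG, x]` and `[F, x]⁻¹ = [F*, θ_F(x)]`. -/
noncomputable instance : ArrowGroupoid (Germ Λ) where
  Comp g h := g.src = h.rng
  mul g h c := Germ.mul g h c
  inv := Germ.inv
  inv_inv g := by
    obtain ⟨F, x, hx, rfl⟩ := g.exists_rep
    simp only [Germ.inv_germ]
    obtain ⟨a, b, h1, h2⟩ := mem_dom_iff.1 hx
    refine (germ_eq_iff _ _).2 ⟨theta_star_theta hx _, a, b, h1, h1, ?_⟩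
    rwa [theta_star_theta hx]
  assoc g h l := by
    obtain ⟨F, x, hx, rfl⟩ := g.exists_rep
    obtain ⟨G, y, hy, rfl⟩ := h.exists_rep
    obtain ⟨H, z, hz, rfl⟩ := l.exists_rep
    intro c c'
    refine ⟨c', c.trans (Germ.rng_mul _ _ c').symm, ?_⟩
    obtain rfl : y = theta H z hz := c'
    obtain rfl : x = theta G _ hy := c
    simp only [Germ.mul_germ]
    rw [Germ.mul_germ _ _ _ _ _ _ rfl, Germ.mul_germ _ _ _ _ _ _ (theta_mul _ _ _).symm]
    simp only [mul_assoc]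
  comp_inv g := (Germ.rng_inv g).symm
  inv_mul_cancel g h := by
    intro c
    refine ⟨(Germ.src_inv g).trans (Germ.rng_mul g h c).symm, ?_⟩
    obtain ⟨F, y, hy, rfl⟩ := g.exists_rep
    obtain ⟨G, x, hx, rfl⟩ := h.exists_rep
    obtain rfl : y = theta G x hx := c
    simp only [Germ.mul_germ, Germ.inv_germ]
    rw [Germ.mul_germ _ _ _ _ _ _ (theta_mul _ _ _).symm]
    obtain ⟨a, b, h1, h2⟩ := mem_dom_iff.1 (mem_dom_mul hx hy)
    obtain ⟨m, h3, h4⟩ := mul_rel.1 h1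
    exact (germ_eq_iff _ _).2 ⟨rfl, m, b,
      mul_rel.2 ⟨a, star_rel.2 h3, h1⟩, h4, h2⟩
  mul_inv_cancel g h := by
    intro c
    refine ⟨(Germ.src_mul g h c).trans (Germ.rng_inv h).symm, ?_⟩
    obtain ⟨F, y, hy, rfl⟩ := g.exists_rep
    obtain ⟨G, x, hx, rfl⟩ := h.exists_rep
    obtain rfl : y = theta G x hx := c
    simp only [Germ.mul_germ, Germ.inv_germ]
    rw [Germ.mul_germ _ _ _ _ _ _ (theta_star_theta hx _).symm]
    obtain ⟨a, b, h1, h2⟩ := mem_dom_iff.1 (mem_dom_mul hx hy)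
    obtain ⟨m, h3, h4⟩ := mul_rel.1 h1
    exact (germ_eq_iff _ _).2 ⟨rfl, a, m,
      mul_rel.2 ⟨b, h1, star_rel.2 h4⟩, h3,
      (starts_theta_iff hx m).2 ⟨m, b, h4, h2, Pre.refl _⟩⟩

/-- `Ψ(F) = {[F, x] : x ∈ D_F}`. -/
def Psi (F : SLambda Λ) : Set (Germ Λ) := {g | ∃ x hx, g = germ F x hx}

/-- The topology of the groupoid of germs, with subbasis the sets `Ψ(F)` and their complements. -/
instance : TopologicalSpace (Germ Λ) :=
  TopologicalSpace.generateFrom {U | ∃ F : SLambda Λ, U = Psi F ∨ U = (Psi F)ᶜ}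

/-- The germ `[{(r(x), r(x))}, x]`. -/
def unitGerm (x : PathSpace Λ) : Germ Λ :=
  germ (single x.rng x.rng rfl) x ⟨(x.rng, x.rng), rfl, x.starts_rng⟩

end GermGroupoid

end KGraph

/-!
A path `x` is determined by the set of its initial segments, and the sets that occur are exactly
the nonempty, hereditary and directed subsets ("filters") of `Λ` under the initial segment order
(`PathSpace.ext_starts`, `PathSpace.exists_of_filter`). Every `D_F` is a finite union of cylinder
sets `cylinder b`, so the topology of `X_Λ` is that of pointwise convergence of these filters. For
`Λ` finitely aligned, directedness passes to limits: `cylinder b ∩ cylinder c` is the finite union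
of the cylinder sets of the minimal common extensions of `b` and `c`. Hence each `D_F` is compact
and clopen (`PathSpace.isCompact_dom`).

The topology of the groupoid of germs is transported from `X_Λ` along the maps `x ↦ [F, x]`. Such a
map is continuous on `D_F`, because the set of paths at which `F` and `G` have the same germ is
again a finite union of cylinder sets (`isClopen_agree`). The source map is continuous, because
`Ψ(F) ∩ s⁻¹(cylinder b) = Ψ(F {(b, b)})`. So `s` restricts to a homeomorphism of `Ψ(F)` onto `D_F`
(`PsiHomeomorph`), and `Ψ(F)` is compact and clopen. Everything else is read off from this:

* on `Ψ(F) × Ψ(G)` the product is `(g, h) ↦ [FG, s(h)]`, and inversion maps `Ψ(F)` to `Ψ(F*)`;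
* the units are the germs of idempotents, `x ↦ [{(r(x), r(x))}, x]` is locally of the form
  `x ↦ [P, x]`, and the source map is its inverse;
* points are separated by clopen sets, so by local compactness the clopen sets form a basis, and a
  clopen subset of some `Ψ(F)` is a compact open bisection.

Injectivity of `Ψ` uses that `X_Λ` contains the finite paths: at the path `b`, a germ in
`Ψ(F) ∩ Ψ(G)` gives a pair `(a, b)` that is related by both `F` and `G`.
-/

namespace KGraph

/-! ### Minimal common extensions of pairs -/

section Alignment

variable {k : ℕ} {Λ : Type u} [KGraph k Λ]

/-- A common extension `(at, bt) = (ct', et')` of the pairs `(a, b)` and `(c, e)` factors through a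
single `u` that is a minimal extension in both coordinates: the two minimal extensions have the same
degree, since `d(t) - d(t')` is both `d(c) - d(a)` and `d(e) - d(b)`. -/
theorem exists_mem_minExt_inter {a b c e t t' : Λ} (h : s a = s b) (h' : s c = s e)
    (ht : s a = r t) (ht' : s c = r t') (e₁ : comp a t = comp c t')
    (e₂ : comp b t = comp e t') :
    ∃ u ∈ minExt a c ∩ minExt b e, ∃ w, s u.1 = r w ∧ t = comp u.1 w := by
  obtain ⟨u, hu, w, hw1, hw2, hu1, hu2⟩ := exists_minExt ht ht' e₁
  obtain ⟨v, hv, w', hv1, hv2, hv3, hv4⟩ := exists_minExt (h.symm.trans ht) (h'.symm.trans ht') e₂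
  have hd : d u.1 = d v.1 := by
    have h1 := hu.2.2.2
    have h2 := hv.2.2.2
    have h3 := congrArg d e₁
    have h4 := congrArg d e₂
    rw [d_comp _ _ hu.1] at h1
    rw [d_comp _ _ hv.1] at h2
    rw [d_comp _ _ ht, d_comp _ _ ht'] at h3
    rw [d_comp _ _ (h.symm.trans ht), d_comp _ _ (h'.symm.trans ht')] at h4
    funext i
    have h1 := congrFun h1 i
    have h2 := congrFun h2 i
    have h3 := congrFun h3 i
    have h4 := congrFun h4 i
    simp only [Pi.add_apply, Pi.sup_apply] at h1 h2 h3 h4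
    omega
  obtain ⟨e3, rfl⟩ := fact_unique hw1 hv1 (hu1.symm.trans hv3) hd
  have e4 : u.2 = v.2 := comp_right_cancel hw2 hv2 (hu2.symm.trans hv4)
  have huv : u = v := Prod.ext e3 e4
  exact ⟨u, ⟨hu, huv ▸ hv⟩, w, hw1, hu1⟩

end Alignment

/-! ### Paths and filters of initial segments -/

namespace PathSpace

variable {k : ℕ} {Λ : Type u} [KGraph k Λ]

/-- A nonempty, hereditary and directed set of elements of `Λ` is the set of initial segments of an
element of the path space. Its degree is the supremum of the degrees of the given segments. -/
theorem exists_of_filter (P : Λ → Prop) {b₀ : Λ} (h₀ : P b₀)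
    (hpre : ∀ b c, Pre b c → P c → P b)
    (hdir : ∀ b c, P b → P c → ∃ e, P e ∧ Pre b e ∧ Pre c e) :
    ∃ x : PathSpace Λ, ∀ b, x.Starts b ↔ P b := by
  classical
  set m : Fin k → ℕ∞ := fun i => ⨆ b : {b // P b}, (d b.1 i : ℕ∞) with hm
  have hle : ∀ b, P b → ∀ i, (d b i : ℕ∞) ≤ m i := fun b hb i =>
    le_iSup (fun b : {b // P b} => (d b.1 i : ℕ∞)) ⟨b, hb⟩
  have hone : ∀ (n : Fin k → ℕ), (∀ i, (n i : ℕ∞) ≤ m i) → ∀ i, ∃ b, P b ∧ n i ≤ d b i := by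
    intro n hn i
    rcases Nat.eq_zero_or_pos (n i) with h | h
    · exact ⟨b₀, h₀, by omega⟩
    by_contra! hc
    have h1 : m i ≤ ((n i - 1 : ℕ) : ℕ∞) := iSup_le fun b => by
      have := hc b.1 b.2
      exact_mod_cast (by omega : d b.1 i ≤ n i - 1)
    have h2 := (hn i).trans h1
    have : n i ≤ n i - 1 := by exact_mod_cast h2
    omega
  -- directedness collects the bounds in the finitely many coordinates into one segment
  have hall : ∀ (n : Fin k → ℕ), (∀ i, (n i : ℕ∞) ≤ m i) → ∃ b, P b ∧ n ≤ d b := by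
    intro n hn
    have : ∀ I : Finset (Fin k), ∃ b, P b ∧ ∀ i ∈ I, n i ≤ d b i := by
      intro I
      induction I using Finset.induction_on with
      | empty => exact ⟨b₀, h₀, by simp⟩
      | insert i I _ ih =>
        obtain ⟨b, hb, hb'⟩ := ih
        obtain ⟨c, hc, hc'⟩ := hone n hn i
        obtain ⟨e, he, h1, h2⟩ := hdir b c hb hc
        refine ⟨e, he, fun j hj => ?_⟩
        rcases Finset.mem_insert.1 hj with rfl | hj
        · exact hc'.trans (h2.d_le j)
        · exact (hb' j hj).trans (h1.d_le j)
    obtain ⟨b, hb, h⟩ := this Finset.univ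
    exact ⟨b, hb, fun i => h i (Finset.mem_univ i)⟩
  have hex : ∀ (n : Fin k → ℕ), (∀ i, (n i : ℕ∞) ≤ m i) → ∃ b, P b ∧ d b = n := by
    intro n hn
    obtain ⟨b, hb, h⟩ := hall n hn
    obtain ⟨c, hc, hc'⟩ := exists_pre h
    exact ⟨c, hpre _ _ hc hb, hc'⟩
  choose f hf hfd using hex
  obtain ⟨x, -, hx⟩ := exists_of_prefixes m f hfd fun n hn n' hn' hnn => by
    obtain ⟨e, -, h1, h2⟩ := hdir _ _ (hf n hn) (hf n' hn')
    exact h1.of_le h2 (by rwa [hfd, hfd])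
  refine ⟨x, fun b => (hx b).trans ⟨?_, fun hb => ⟨hle b hb, ?_⟩⟩⟩
  · rintro ⟨h, e⟩
    exact e ▸ hf _ h
  · obtain ⟨e, -, h1, h2⟩ := hdir _ _ (hf (d b) (hle b hb)) hb
    exact h1.eq h2 (hfd _ _)

/-- The path with finitely many initial segments that is given by an element `a` of `Λ`. -/
theorem exists_starts_iff_pre (a : Λ) : ∃ x : PathSpace Λ, ∀ b, x.Starts b ↔ Pre b a :=
  exists_of_filter (fun b => Pre b a) (Pre.refl a) (fun _ _ => Pre.trans)
    fun _ _ h h' => ⟨a, Pre.refl a, h, h'⟩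

/-! ### The topology of the path space -/

/-- The cylinder set of all paths with initial segment `b`. -/
def cylinder (b : Λ) : Set (PathSpace Λ) := {x | x.Starts b}

theorem cylinder_anti {b c : Λ} (h : Pre b c) : cylinder c ⊆ cylinder b := fun _ hx => hx.pre h

theorem cylinder_inter (b c : Λ) :
    cylinder b ∩ cylinder c = ⋃ p ∈ minExt b c, cylinder (comp b p.1) := by
  ext x
  simp only [Set.mem_iUnion, exists_prop]
  constructor
  · rintro ⟨hb, hc⟩
    obtain ⟨e, he, ⟨y, hy, rfl⟩, ⟨z, hz, hz'⟩⟩ := Starts.directed hb hc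
    obtain ⟨p, hp, t, ht, -, rfl, -⟩ := exists_minExt hy hz hz'.symm
    refine ⟨p, hp, he.pre ⟨t, ?_, assoc _ _ _ hp.1 ht⟩⟩
    rw [s_comp _ _ hp.1, ht]
  · rintro ⟨p, ⟨h1, h2, h3, -⟩, hx⟩
    exact ⟨hx.pre (pre_comp h1), hx.pre (h3 ▸ pre_comp h2)⟩

theorem dom_eq_biUnion (F : SLambda Λ) : dom F = ⋃ p ∈ F.carrier, cylinder p.2 := by
  ext x
  simp [dom, cylinder]

theorem dom_single {a b : Λ} (h : s a = s b) : dom (SLambda.single a b h) = cylinder b := by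
  rw [dom_eq_biUnion]
  exact Set.biUnion_singleton (a, b) fun p : Λ × Λ => cylinder p.2

theorem isClopen_dom (F : SLambda Λ) : IsClopen (dom F) :=
  ⟨⟨TopologicalSpace.isOpen_generateFrom_of_mem ⟨F, Or.inr rfl⟩⟩,
    TopologicalSpace.isOpen_generateFrom_of_mem ⟨F, Or.inl rfl⟩⟩

theorem continuous_iff {X : Type*} [TopologicalSpace X] {f : X → PathSpace Λ} :
    Continuous f ↔ ∀ F : SLambda Λ, IsClopen (f ⁻¹' dom F) := by
  refine ⟨fun h F => (isClopen_dom F).preimage h, fun h => continuous_generateFrom_iff.2 ?_⟩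
  rintro _ ⟨F, rfl | rfl⟩
  · exact (h F).isOpen
  · exact (h F).compl.isOpen

theorem isClopen_cylinder (b : Λ) : IsClopen (cylinder b) :=
  dom_single (Λ := Λ) (a := b) rfl ▸ isClopen_dom _

instance : TotallySeparatedSpace (PathSpace Λ) := by
  refine totallySeparatedSpace_iff_exists_isClopen.2 fun x y hxy => ?_
  by_contra! hc
  refine hxy (ext_starts fun b => ⟨fun hb => ?_, fun hb => ?_⟩)
  · by_contra hb'
    exact hc _ (isClopen_cylinder b) hb hb'
  · by_contra hb'
    exact hc _ (isClopen_cylinder b).compl hb' fun h => h hb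

variable [FinitelyAligned Λ]

/-- If an ultrafilter contains `D_F`, then the `b` whose cylinder sets it contains are the initial
segments of a path, to which it converges; finite alignment makes this set of `b` directed. -/
theorem isCompact_dom (F : SLambda Λ) : IsCompact (dom F) := by
  refine isCompact_iff_ultrafilter_le_nhds.2 fun U hU => ?_
  have hdom : ∀ G : SLambda Λ, dom G ∈ U ↔ ∃ p ∈ G.carrier, cylinder p.2 ∈ U := fun G => by
    rw [dom_eq_biUnion, Ultrafilter.finite_biUnion_mem_iff G.finite]
  obtain ⟨p, hp, hpU⟩ := (hdom F).1 (Filter.le_principal_iff.1 hU)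
  obtain ⟨x, hx⟩ := exists_of_filter (fun b => cylinder b ∈ U) hpU
    (fun b c h hc => Filter.mem_of_superset hc (cylinder_anti h)) (fun b c hb hc => by
      have h := Filter.inter_mem hb hc
      rw [cylinder_inter, Ultrafilter.mem_coe,
        Ultrafilter.finite_biUnion_mem_iff (FinitelyAligned.finite b c)] at h
      obtain ⟨q, ⟨h1, h2, h3, -⟩, hq⟩ := h
      exact ⟨_, hq, pre_comp h1, h3 ▸ pre_comp h2⟩)
  have hxdom : ∀ G : SLambda Λ, x ∈ dom G ↔ dom G ∈ U := fun G => by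
    rw [hdom]
    exact exists_congr fun q => and_congr_right fun _ => hx q.2
  refine ⟨x, (hxdom F).2 (Filter.le_principal_iff.1 hU), ?_⟩
  rw [TopologicalSpace.nhds_generateFrom]
  refine le_iInf₂ fun V hV => Filter.le_principal_iff.2 ?_
  obtain ⟨hxV, G, rfl | rfl⟩ := hV
  · exact (hxdom G).1 hxV
  · exact Ultrafilter.compl_mem_iff_notMem.2 fun h => hxV ((hxdom G).2 h)

end PathSpace

/-! ### The sets `Ψ(F)` and the algebra of germs -/

section Germs

variable {k : ℕ} {Λ : Type u} [KGraph k Λ]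

open SLambda PathSpace ArrowGroupoid

theorem SLambda.star_star (F : SLambda Λ) : star (star F) = F :=
  ext_rel fun a b => by rw [star_rel, star_rel]

variable [FinitelyAligned Λ]

theorem germ_mem_Psi_iff {F G : SLambda Λ} {x : PathSpace Λ} (hx : x ∈ dom F) :
    germ F x hx ∈ Psi G ↔ ∃ a b, F.Rel a b ∧ G.Rel a b ∧ x.Starts b := by
  constructor
  · rintro ⟨y, hy, e⟩
    exact ((germ_eq_iff _ _).1 e).2
  · rintro ⟨a, b, h1, h2, h3⟩
    exact ⟨x, mem_dom_iff.2 ⟨a, b, h2, h3⟩, (germ_eq_iff _ _).2 ⟨rfl, a, b, h1, h2, h3⟩⟩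

theorem germ_mem_Psi (F : SLambda Λ) {x : PathSpace Λ} (hx : x ∈ dom F) :
    germ F x hx ∈ Psi F := ⟨x, hx, rfl⟩

theorem exists_mem_Psi (g : Germ Λ) : ∃ F : SLambda Λ, g ∈ Psi F := by
  obtain ⟨F, x, hx, rfl⟩ := g.exists_rep
  exact ⟨F, germ_mem_Psi F hx⟩

theorem src_mem_dom {F : SLambda Λ} {g : Germ Λ} (h : g ∈ Psi F) : g.src ∈ dom F := by
  obtain ⟨x, hx, rfl⟩ := h
  exact hx

theorem germ_src {F : SLambda Λ} {g : Germ Λ} (h : g ∈ Psi F) :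
    germ F g.src (src_mem_dom h) = g := by
  obtain ⟨x, hx, rfl⟩ := h
  rfl

/-- Testing `Ψ(F) ⊆ Ψ(G)` on the finite path `b` gives `(a, b)` as a common pair. -/
theorem rel_of_Psi_subset {F G : SLambda Λ} (h : Psi F ⊆ Psi G) {a b : Λ} (hab : F.Rel a b) :
    G.Rel a b := by
  obtain ⟨x, hx⟩ := exists_starts_iff_pre b
  have hxF : x ∈ dom F := mem_dom_iff.2 ⟨a, b, hab, (hx b).2 (Pre.refl b)⟩
  obtain ⟨a', b', h1, h2, h3⟩ := (germ_mem_Psi_iff hxF).1 (h (germ_mem_Psi F hxF))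
  obtain ⟨c, hc, rfl⟩ := (hx b').1 h3
  have hc' := h1.s_eq.trans hc
  rw [hab.left_unique (h1.comp hc')]
  exact h2.comp hc'

theorem Psi_injective : Function.Injective (Psi : SLambda Λ → Set (Germ Λ)) := fun _ _ h =>
  ext_rel fun _ _ => ⟨rel_of_Psi_subset h.le, rel_of_Psi_subset h.ge⟩

theorem Psi_mul (F G : SLambda Λ) : Psi (F * G) = setMul (Psi F) (Psi G) := by
  ext g
  constructor
  · rintro ⟨x, hx, rfl⟩
    obtain ⟨a, c, h1, h2⟩ := mem_dom_iff.1 hx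
    obtain ⟨b, h3, h4⟩ := mul_rel.1 h1
    have hG : x ∈ dom G := mem_dom_iff.2 ⟨b, c, h4, h2⟩
    have hF : theta G x hG ∈ dom F :=
      mem_dom_iff.2 ⟨a, b, h3, (starts_theta_iff hG b).2 ⟨b, c, h4, h2, Pre.refl b⟩⟩
    exact ⟨_, germ_mem_Psi F hF, _, germ_mem_Psi G hG, rfl, (Germ.mul_germ _ _ _ _ hG hF rfl).symm⟩
  · rintro ⟨_, ⟨y, hy, rfl⟩, _, ⟨x, hx, rfl⟩, c, rfl⟩
    obtain rfl : y = theta G x hx := c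
    exact ⟨x, _, Germ.mul_germ _ _ _ _ hx hy rfl⟩

theorem mul_mem_Psi_mul {F G : SLambda Λ} {g h : Germ Λ} (hg : g ∈ Psi F) (hh : h ∈ Psi G)
    (c : Comp g h) : mul g h c ∈ Psi (F * G) := by
  rw [Psi_mul]
  exact ⟨g, hg, h, hh, c, rfl⟩

theorem inv_mem_Psi_star {F : SLambda Λ} {g : Germ Λ} (h : g ∈ Psi F) :
    inv g ∈ Psi (star F) := by
  obtain ⟨x, hx, rfl⟩ := h
  exact ⟨_, _, rfl⟩

theorem inv_mem_Psi_iff {F : SLambda Λ} {g : Germ Λ} : inv g ∈ Psi F ↔ g ∈ Psi (star F) := by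
  constructor
  · intro h
    rw [← inv_inv g]
    exact inv_mem_Psi_star h
  · intro h
    rw [← SLambda.star_star F]
    exact inv_mem_Psi_star h

theorem Psi_star (F : SLambda Λ) : Psi (star F) = setInv (Psi F) := by
  ext g
  constructor
  · intro h
    exact ⟨inv g, inv_mem_Psi_iff.2 h, inv_inv g⟩
  · rintro ⟨h, hh, rfl⟩
    exact inv_mem_Psi_star hh

@[simp]
theorem src_unitGerm (x : PathSpace Λ) : (unitGerm x).src = x := rfl

theorem unitGerm_eq_germ {x : PathSpace Λ} {P : SLambda Λ} (hP : P * P = P) (hx : x ∈ dom P) :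
    unitGerm x = germ P x hx := by
  refine (germ_eq_iff _ _).2 ⟨rfl, ?_⟩
  obtain ⟨a, b, h1, h2⟩ := mem_dom_iff.1 hx
  obtain rfl := rel_idem hP h1
  have hr := h2.rng_eq
  refine ⟨a, a, single_rel _ |>.2 ⟨a, ?_, ?_, ?_⟩, h1, h2⟩
  · rw [s_rng, hr]
  all_goals rw [← hr, id_comp]

theorem mul_star_idem (F : SLambda Λ) : (F * star F) * (F * star F) = F * star F := by
  have key : ∀ a b, (F * star F).Rel a b → a = b := fun a b h => by
    obtain ⟨c, h1, h2⟩ := mul_rel.1 h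
    exact h1.left_unique (star_rel.1 h2)
  refine ext_rel fun a b => mul_rel.trans ⟨?_, fun h => ⟨a, ?_, h⟩⟩
  · rintro ⟨c, h1, h2⟩
    rwa [key _ _ h1]
  · obtain rfl := key _ _ h
    exact h

theorem coe_rangeMap (g : Germ Λ) : (rangeMap g : Germ Λ) = unitGerm g.rng := by
  obtain ⟨F, x, hx, rfl⟩ := g.exists_rep
  refine Eq.trans ?_ (unitGerm_eq_germ (mul_star_idem F)
    (mem_dom_mul (theta_mem_dom_star hx) (by rwa [theta_star_theta hx]))).symm
  exact Germ.mul_germ _ _ _ _ _ _ (theta_star_theta hx _).symm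

theorem rangeMap_inv (g : Germ Λ) : rangeMap (inv g) = sourceMap g := by
  refine Subtype.ext ?_
  show mul (inv g) (inv (inv g)) _ = mul (inv g) g _
  congr 1
  exact inv_inv g

theorem coe_sourceMap (g : Germ Λ) : (sourceMap g : Germ Λ) = unitGerm g.src := by
  rw [← rangeMap_inv, coe_rangeMap]
  exact congrArg unitGerm (Germ.rng_inv g)

theorem range_unitGerm :
    Set.range (unitGerm : PathSpace Λ → Germ Λ) = unitSpace (Germ Λ) := by
  ext g
  constructor
  · rintro ⟨x, rfl⟩
    rw [← src_unitGerm x, ← coe_sourceMap]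
    exact (sourceMap _).2
  · rintro ⟨h, rfl⟩
    exact ⟨h.rng, (coe_rangeMap h).symm⟩

end Germs

/-! ### The topology of the groupoid of germs -/

section GermTopology

variable {k : ℕ} {Λ : Type u} [KGraph k Λ] [FinitelyAligned Λ]

open SLambda PathSpace ArrowGroupoid Topology

theorem isClopen_Psi (F : SLambda Λ) : IsClopen (Psi F) :=
  ⟨⟨TopologicalSpace.isOpen_generateFrom_of_mem ⟨F, Or.inr rfl⟩⟩,
    TopologicalSpace.isOpen_generateFrom_of_mem ⟨F, Or.inl rfl⟩⟩

theorem continuous_germ_iff {X : Type*} [TopologicalSpace X] {f : X → Germ Λ} :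
    Continuous f ↔ ∀ F : SLambda Λ, IsClopen (f ⁻¹' Psi F) := by
  refine ⟨fun h F => (isClopen_Psi F).preimage h, fun h => continuous_generateFrom_iff.2 ?_⟩
  rintro _ ⟨F, rfl | rfl⟩
  · exact (h F).isOpen
  · exact (h F).compl.isOpen

/-- The set of paths on which `F` and `G` have the same germ is a finite union of cylinder sets,
one for each pair `u` that is a minimal extension both of the ranges and of the sources. -/
theorem isClopen_agree (F G : SLambda Λ) :
    IsClopen {x : PathSpace Λ | ∃ a b, F.Rel a b ∧ G.Rel a b ∧ x.Starts b} := by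
  have : {x : PathSpace Λ | ∃ a b, F.Rel a b ∧ G.Rel a b ∧ x.Starts b} =
      ⋃ p ∈ F.carrier, ⋃ q ∈ G.carrier, ⋃ u ∈ minExt p.1 q.1 ∩ minExt p.2 q.2,
        cylinder (comp p.2 u.1) := by
    ext x
    simp only [Set.mem_iUnion, exists_prop]
    constructor
    · rintro ⟨a, b, ⟨p, hp, t, ht, rfl, rfl⟩, ⟨q, hq, t', ht', e1, e2⟩, hx⟩
      obtain ⟨u, hu, w, hw, rfl⟩ := exists_mem_minExt_inter (F.source_eq p hp)
        (G.source_eq q hq) ht ht' e1 e2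
      refine ⟨p, hp, q, hq, u, hu, Starts.pre hx ⟨w, ?_, assoc _ _ _ hu.2.1 hw⟩⟩
      rw [s_comp _ _ hu.2.1, hw]
    · rintro ⟨p, hp, q, hq, u, ⟨hu, hu'⟩, hx⟩
      exact ⟨_, _, (rel_of_mem hp).comp hu.1,
        by rw [hu.2.2.1, hu'.2.2.1]; exact (rel_of_mem hq).comp hu.2.1, hx⟩
  rw [this]
  exact F.finite.isClopen_biUnion fun p _ => G.finite.isClopen_biUnion fun q _ =>
    ((FinitelyAligned.finite _ _).inter_of_left _).isClopen_biUnion fun u _ => isClopen_cylinder _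

theorem continuous_germ (F : SLambda Λ) :
    Continuous fun x : dom F => germ F (x : PathSpace Λ) x.2 := by
  refine continuous_germ_iff.2 fun G => ?_
  have : (fun x : dom F => germ F (x : PathSpace Λ) x.2) ⁻¹' Psi G =
      Subtype.val ⁻¹' {x : PathSpace Λ | ∃ a b, F.Rel a b ∧ G.Rel a b ∧ x.Starts b} := by
    ext x
    exact germ_mem_Psi_iff x.2
  rw [this]
  exact (isClopen_agree F G).preimage continuous_subtype_val

theorem mem_Psi_mul_single {F : SLambda Λ} {b : Λ} {g : Germ Λ} :
    g ∈ Psi (F * single b b rfl) ↔ g ∈ Psi F ∧ g.src ∈ cylinder b := by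
  constructor
  · rintro ⟨x, hx, rfl⟩
    obtain ⟨a, c, h1, h2⟩ := mem_dom_iff.1 hx
    obtain ⟨c', h3, h4⟩ := mul_rel.1 h1
    obtain rfl := rel_idem (single_idem b) h4
    refine ⟨(germ_mem_Psi_iff hx).2 ⟨a, c', h1, h3, h2⟩, ?_⟩
    rw [Germ.src_germ, ← dom_single (a := b) rfl]
    exact mem_dom_iff.2 ⟨_, _, h4, h2⟩
  · rintro ⟨⟨x, hx, rfl⟩, hb⟩
    obtain ⟨a, c, h1, h2⟩ := mem_dom_iff.1 hx
    obtain ⟨e, h3, h4, t, ht, rfl⟩ := h2.directed hb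
    obtain ⟨a', -, h5⟩ := h1.right_pre h4
    exact (germ_mem_Psi_iff hx).2
      ⟨a', _, h5, mul_rel.2 ⟨_, h5, (single_rel rfl).2 ⟨t, ht, rfl, rfl⟩⟩, h3⟩

theorem continuous_src : Continuous (Germ.src : Germ Λ → PathSpace Λ) := by
  have key : ∀ b : Λ, IsClopen (Germ.src ⁻¹' cylinder b : Set (Germ Λ)) := by
    intro b
    constructor
    · refine ⟨isOpen_iff_forall_mem_open.2 fun g hg => ?_⟩
      obtain ⟨F, hF⟩ := exists_mem_Psi g
      exact ⟨Psi F \ Psi (F * single b b rfl), fun h hh hb => hh.2 (mem_Psi_mul_single.2 ⟨hh.1, hb⟩),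
        (isClopen_Psi _).isOpen.sdiff (isClopen_Psi _).isClosed,
        hF, fun h => hg (mem_Psi_mul_single.1 h).2⟩
    · refine isOpen_iff_forall_mem_open.2 fun g hg => ?_
      obtain ⟨F, hF⟩ := exists_mem_Psi g
      exact ⟨Psi (F * single b b rfl), fun h hh => (mem_Psi_mul_single.1 hh).2,
        (isClopen_Psi _).isOpen, mem_Psi_mul_single.2 ⟨hF, hg⟩⟩
  refine PathSpace.continuous_iff.2 fun F => ?_
  rw [dom_eq_biUnion, Set.preimage_iUnion₂]
  exact F.finite.isClopen_biUnion fun p _ => key p.2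

theorem continuous_germ_inv : Continuous (inv : Germ Λ → Germ Λ) := by
  refine continuous_germ_iff.2 fun F => ?_
  have : inv ⁻¹' Psi F = Psi (star F) := Set.ext fun g => inv_mem_Psi_iff
  rw [this]
  exact isClopen_Psi _

/-- On `Ψ(F) × Ψ(G)` the product is `(g, h) ↦ [FG, s(h)]`, which is continuous in `h`. -/
theorem continuous_germ_mul :
    Continuous fun p : {p : Germ Λ × Germ Λ // Comp p.1 p.2} => mul p.1.1 p.1.2 p.2 := by
  refine continuous_iff_continuousAt.2 fun p => ?_
  obtain ⟨F, hF⟩ := exists_mem_Psi p.1.1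
  obtain ⟨G, hG⟩ := exists_mem_Psi p.1.2
  set N : Set {p : Germ Λ × Germ Λ // Comp p.1 p.2} := {q | q.1.1 ∈ Psi F ∧ q.1.2 ∈ Psi G}
  have hN : IsOpen N :=
    ((isClopen_Psi F).isOpen.preimage (continuous_fst.comp continuous_subtype_val)).inter
      ((isClopen_Psi G).isOpen.preimage (continuous_snd.comp continuous_subtype_val))
  refine ContinuousOn.continuousAt (s := N) ?_ (hN.mem_nhds ⟨hF, hG⟩)
  rw [continuousOn_iff_continuous_domRestrict]
  have hmem : ∀ q : N, mul q.1.1.1 q.1.1.2 q.1.2 ∈ Psi (F * G) := fun q =>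
    mul_mem_Psi_mul q.2.1 q.2.2 q.1.2
  have hsrc : ∀ q : N, q.1.1.2.src ∈ dom (F * G) := fun q => by
    have := src_mem_dom (hmem q)
    exact this
  refine ((continuous_germ (F * G)).comp (f := fun q : N => ⟨q.1.1.2.src, hsrc q⟩)
    (Continuous.subtype_mk (continuous_src.comp (continuous_snd.comp
      (continuous_subtype_val.comp continuous_subtype_val))) hsrc)).congr fun q => ?_
  exact germ_src (hmem q)

theorem continuous_unitGerm : Continuous (unitGerm : PathSpace Λ → Germ Λ) := by
  refine continuous_iff_continuousAt.2 fun x => ?_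
  have hx : x ∈ dom (single x.rng x.rng rfl) := ⟨(x.rng, x.rng), rfl, x.starts_rng⟩
  refine ContinuousOn.continuousAt ?_ ((isClopen_dom _).isOpen.mem_nhds hx)
  rw [continuousOn_iff_continuous_domRestrict]
  exact (continuous_germ _).congr fun y => (unitGerm_eq_germ (single_idem _) y.2).symm

theorem isOpen_unitSpace_germ : IsOpen (unitSpace (Germ Λ)) := by
  rw [← range_unitGerm]
  refine isOpen_iff_forall_mem_open.2 ?_
  rintro _ ⟨x, rfl⟩
  refine ⟨Psi (single x.rng x.rng rfl), ?_, (isClopen_Psi _).isOpen, _, _, rfl⟩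
  rintro _ ⟨y, hy, rfl⟩
  exact ⟨y, unitGerm_eq_germ (single_idem _) hy⟩

theorem isOpenEmbedding_unitGerm : IsOpenEmbedding (unitGerm : PathSpace Λ → Germ Λ) :=
  ⟨Function.LeftInverse.isEmbedding src_unitGerm continuous_src continuous_unitGerm,
    by rw [range_unitGerm]; exact isOpen_unitSpace_germ⟩

instance : TotallySeparatedSpace (Germ Λ) := by
  refine totallySeparatedSpace_iff_exists_isClopen.2 fun g h hgh => ?_
  by_cases e : g.src = h.src
  · obtain ⟨F, x, hx, rfl⟩ := g.exists_rep
    refine ⟨Psi F, isClopen_Psi F, germ_mem_Psi F hx, fun hh => hgh ?_⟩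
    obtain ⟨y, hy, rfl⟩ := hh
    obtain rfl : x = y := e
    rfl
  · obtain ⟨U, hU, h1, h2⟩ := exists_isClopen_of_totally_separated e
    exact ⟨_, hU.preimage continuous_src, h1, h2⟩

/-- The source map identifies `Ψ(F)` with `D_F`; its inverse is `x ↦ [F, x]`. -/
def PsiHomeomorph (F : SLambda Λ) : Psi F ≃ₜ dom F where
  toFun g := ⟨g.1.src, src_mem_dom g.2⟩
  invFun x := ⟨germ F x x.2, germ_mem_Psi F x.2⟩
  left_inv g := Subtype.ext (germ_src g.2)
  right_inv _ := rfl
  continuous_toFun := (continuous_src.comp continuous_subtype_val).subtype_mk _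
  continuous_invFun := (continuous_germ F).subtype_mk _

theorem isCompact_Psi (F : SLambda Λ) : IsCompact (Psi F) := by
  have := isCompact_iff_compactSpace.1 (isCompact_dom F)
  exact isCompact_iff_compactSpace.2 (PsiHomeomorph F).symm.compactSpace

theorem isOpenEmbedding_src_Psi (F : SLambda Λ) :
    IsOpenEmbedding fun g : Psi F => (g : Germ Λ).src :=
  (isClopen_dom F).isOpen.isOpenEmbedding_subtypeVal.comp (PsiHomeomorph F).isOpenEmbedding

theorem isOpenEmbedding_sourceMap_Psi (F : SLambda Λ) :
    IsOpenEmbedding fun g : Psi F => sourceMap (g : Germ Λ) := by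
  refine IsOpenEmbedding.of_comp _ isOpen_unitSpace_germ.isOpenEmbedding_subtypeVal ?_
  have : Subtype.val ∘ (fun g : Psi F => sourceMap (g : Germ Λ)) =
      unitGerm ∘ fun g : Psi F => (g : Germ Λ).src := funext fun g => coe_sourceMap _
  rw [this]
  exact isOpenEmbedding_unitGerm.comp (isOpenEmbedding_src_Psi F)

/-- Inversion as a homeomorphism of the groupoid of germs. -/
noncomputable def germInvHomeomorph : Germ Λ ≃ₜ Germ Λ where
  toFun := inv
  invFun := inv
  left_inv := inv_inv
  right_inv := inv_inv
  continuous_toFun := continuous_germ_inv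
  continuous_invFun := continuous_germ_inv

theorem isOpenEmbedding_rangeMap_Psi (F : SLambda Λ) :
    IsOpenEmbedding fun g : Psi F => rangeMap (g : Germ Λ) := by
  have h : ∀ g : Germ Λ, g ∈ Psi F ↔ germInvHomeomorph g ∈ Psi (star F) := fun g =>
    (inv_mem_Psi_iff.trans (by rw [SLambda.star_star])).symm
  have : (fun g : Psi F => rangeMap (g : Germ Λ)) =
      (fun g : Psi (star F) => sourceMap (g : Germ Λ)) ∘ germInvHomeomorph.subtype h :=
    funext fun g => ((rangeMap_inv _).symm.trans (congrArg rangeMap (inv_inv _))).symm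
  rw [this]
  exact (isOpenEmbedding_sourceMap_Psi _).comp (Homeomorph.isOpenEmbedding _)

theorem mem_openBisections_of_subset_Psi {F : SLambda Λ} {A : Set (Germ Λ)} (hA : IsOpen A)
    (h : A ⊆ Psi F) : A ∈ openBisections (Germ Λ) := by
  have hi : IsOpenEmbedding (Set.inclusion h) :=
    IsOpenEmbedding.inclusion h (hA.preimage continuous_subtype_val)
  have hr : IsOpenEmbedding ((fun g : Psi F => rangeMap (g : Germ Λ)) ∘ Set.inclusion h) :=
    (isOpenEmbedding_rangeMap_Psi F).comp hi
  have hs : IsOpenEmbedding ((fun g : Psi F => sourceMap (g : Germ Λ)) ∘ Set.inclusion h) :=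
    (isOpenEmbedding_sourceMap_Psi F).comp hi
  exact ⟨hA, inferInstance, hr, hs⟩

theorem Psi_mem_compactOpenBisections (F : SLambda Λ) :
    Psi F ∈ compactOpenBisections (Germ Λ) :=
  ⟨mem_openBisections_of_subset_Psi (isClopen_Psi F).isOpen subset_rfl, isCompact_Psi F⟩

instance : LocallyCompactSpace (Germ Λ) :=
  have : WeaklyLocallyCompactSpace (Germ Λ) := ⟨fun g => by
    obtain ⟨F, hF⟩ := exists_mem_Psi g
    exact ⟨Psi F, isCompact_Psi F, (isClopen_Psi F).isOpen.mem_nhds hF⟩⟩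
  inferInstance

/-- The clopen sets form a basis, and those contained in some `Ψ(F)` are compact open
bisections. -/
theorem isTopologicalBasis_compactOpenBisections :
    TopologicalSpace.IsTopologicalBasis (compactOpenBisections (Germ Λ)) := by
  refine TopologicalSpace.isTopologicalBasis_of_isOpen_of_nhds (fun A hA => hA.1.1) ?_
  intro g U hg hU
  obtain ⟨F, hF⟩ := exists_mem_Psi g
  obtain ⟨C, hC, hgC, hCU⟩ := loc_compact_Haus_tot_disc_of_zero_dim.exists_subset_of_mem_open
    (show g ∈ U ∩ Psi F from ⟨hg, hF⟩) (hU.inter (isClopen_Psi F).isOpen)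
  have hCF : C ⊆ Psi F := hCU.trans Set.inter_subset_right
  exact ⟨C, ⟨mem_openBisections_of_subset_Psi hC.isOpen hCF,
    (isCompact_Psi F).of_isClosed_subset hC.isClosed hCF⟩, hgC, hCU.trans Set.inter_subset_left⟩

theorem isAmple_germ : IsAmple (Germ Λ) where
  topological := ⟨continuous_germ_mul, continuous_germ_inv⟩
  locallyCompact := inferInstance
  isOpen_unitSpace := isOpen_unitSpace_germ
  isBasis := isTopologicalBasis_compactOpenBisections

theorem secondCountableTopology_germ [Countable Λ] : SecondCountableTopology (Germ Λ) := by
  have hS : Countable (SLambda Λ) := by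
    refine Function.Injective.countable (f := fun F : SLambda Λ => F.finite.toFinset)
      fun F G h => SLambda.ext ?_
    exact Set.Finite.toFinset_inj.1 h
  refine ⟨_, ?_, rfl⟩
  have : {U : Set (Germ Λ) | ∃ F : SLambda Λ, U = Psi F ∨ U = (Psi F)ᶜ} =
      Set.range (Psi : SLambda Λ → Set (Germ Λ)) ∪ Set.range fun F : SLambda Λ => (Psi F)ᶜ := by
    ext U
    simp only [Set.mem_ofPred_eq, Set.mem_union, Set.mem_range, exists_or, eq_comm]
  rw [this]
  exact (Set.countable_range _).union (Set.countable_range _)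

end GermTopology

end KGraph

theorem mainTheorem5 {k : ℕ} (Λ : Type u) [KGraph k Λ] [Countable Λ] [KGraph.FinitelyAligned Λ] :
    -- the groupoid of germs is a (second countable) locally compact Hausdorff ample groupoid
    T2Space (KGraph.Germ Λ) ∧
    SecondCountableTopology (KGraph.Germ Λ) ∧
    ArrowGroupoid.IsAmple (KGraph.Germ Λ) ∧
    -- its unit space is the path space, and its range and source maps are `θ_F(x)` and `x`
    Topology.IsEmbedding (KGraph.unitGerm : KGraph.PathSpace Λ → KGraph.Germ Λ) ∧
    Set.range (KGraph.unitGerm : KGraph.PathSpace Λ → KGraph.Germ Λ) =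
      ArrowGroupoid.unitSpace (KGraph.Germ Λ) ∧
    (∀ (F : KGraph.SLambda Λ) (x : KGraph.PathSpace Λ) (hx : x ∈ KGraph.dom F),
      (ArrowGroupoid.rangeMap (KGraph.germ F x hx) : KGraph.Germ Λ) =
        KGraph.unitGerm (KGraph.theta F x hx) ∧
      (ArrowGroupoid.sourceMap (KGraph.germ F x hx) : KGraph.Germ Λ) = KGraph.unitGerm x) ∧
    -- `Ψ` is an injective `*`-homomorphism into the compact open bisections
    (∀ F : KGraph.SLambda Λ,
      KGraph.Psi F ∈ ArrowGroupoid.compactOpenBisections (KGraph.Germ Λ)) ∧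
    Function.Injective (KGraph.Psi : KGraph.SLambda Λ → Set (KGraph.Germ Λ)) ∧
    (∀ F G : KGraph.SLambda Λ,
      KGraph.Psi (F * G) = ArrowGroupoid.setMul (KGraph.Psi F) (KGraph.Psi G)) ∧
    (∀ F : KGraph.SLambda Λ,
      KGraph.Psi (star F) = ArrowGroupoid.setInv (KGraph.Psi F)) := by
  exact ⟨inferInstance, KGraph.secondCountableTopology_germ, KGraph.isAmple_germ,
    KGraph.isOpenEmbedding_unitGerm.isEmbedding, KGraph.range_unitGerm,
    fun F x hx => ⟨KGraph.coe_rangeMap _, KGraph.coe_sourceMap _⟩,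
    KGraph.Psi_mem_compactOpenBisections, KGraph.Psi_injective, KGraph.Psi_mul, KGraph.Psi_star⟩
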